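/- **Setting.** Let $K$ independent data streams be given. Stream $k\in[K]=\{1,\dots,K\}$ is $X_k=(X_k(n))_{n\ge1}$, and its law is $\mathrm P_{k,\theta}$ for an unknown $\theta$ in a subset $\Theta_k$ of a Euclidean space; $\Theta_k^0,\Theta_k^1$ are disjoint non-empty subsets of $\Theta_k$, and the stream is a *signal* if $\theta\in\Theta_k^1$ and *noise* if $\theta\in\Theta_k^0$. Put $\mathcal F_k(n)=\sigma(X_k(1),\dots,X_k(n))$ and $\mathcal F(n)=\sigma(\mathcal F_1(n),\dots,\mathcal F_K(n))$. For $A\subseteq[K]$ let $\boldsymbol\Theta_A$ be the set of $\boldsymbol\theta=(\theta_1,\dots,\theta_K)$ with $\theta_i\in\Theta_i^1$ for $i\in A$ and $\theta_j\in\Theta_j^0$ for $j\notin A$, let $\mathrm P_{A,\boldsymbol\theta}=\mathrm P_{1,\theta_1}\otimes\cdots\otimes\mathrm P_{K,\theta_K}$, and let $\mathrm E_{A,\boldsymbol\theta}$ be the expectation. Let $\Pi$ be a class of subsets of $[K]$ such that for each $k$ there are $A,B\in\Pi$ with $k\in A$ and $k\notin B$. **Likelihoods.** The law of $(X_k(1),\dots,X_k(n))$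 under $\mathrm P_{k,\theta}$ has density $e^{\ell_k(n,\theta)}$, with $\ell_k(n,\theta)$ real-valued, with respect to a $\sigma$-finite measure $\nu_{k,n}$ that does not depend on $\theta$ and satisfies $\nu_{k,n+1}(dh,dz)=\nu_{k,n}(dh)\,\kappa_{k,n}(h,dz)$ for a kernel $\kappa_{k,n}$; $\ell_k(0,\theta)=0$. The versions are jointly measurable in the parameter and the sample, and for $\nu_{k,n}$-almost every $h$ one has $\int e^{\ell_k(n+1,\theta)(h,z)}\,\kappa_{k,n}(h,dz)=e^{\ell_k(n,\theta)(h)}$ simultaneously for all $\theta\in\Theta_k$. For $i\in\{0,1\}$ let $\ell_k^i(n)=\sup_{\theta\in\Theta_k^i}\ell_k(n,\theta)$, assumed measurable. Let $\hat\theta_k(n)$, $n\ge0$, be $\Theta_k$-valued and $\mathcal F_k(n)$-measurable ($\hat\theta_k(0)$ deterministic), and set $\ell_k^*(0)=0$, $\ell^*_k(n)=\ell^*_k(n-1)+\ell_k(n,\hat\theta_k(n-1))-\ell_k(n-1,\hat\theta_k(n-1))$. The adaptive log-likelihood ratio is $$\lambda_k^*(n)=\begin{cases}\ell_k^*(n)-\ell_k^0(n)&\text{if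 }\ell_k^0(n)<\min\{\ell_k^1(n),\ell_k^*(n)\},\\ \ell_k^1(n)-\ell_k^*(n)&\text{if }\ell_k^1(n)<\min\{\ell_k^0(n),\ell_k^*(n)\},\\0&\text{otherwise.}\end{cases}$$ **Procedures.** A sequential procedure $\chi=(\mathbf T,\mathbf D)$ consists of $\{\mathcal F(n)\}$-stopping times $T_k\geq 1$ and $\mathcal F(T_k)$-measurable decisions $D_k\in\{0,1\}$, $k\in[K]$; write $\mathbf D$ also for $\{k:D_k=1\}$. It belongs to the class $\Delta'$ of decentralized procedures if moreover, for every $k$, $T_k$ is an $\{\mathcal F_k(n)\}$-stopping time and $D_k$ is $\mathcal F_k(T_k)$-measurable. For $\alpha,\beta\in(0,1)$, $\Delta^*(\alpha,\beta,\Pi)$ is the class of sequential procedures such that, for all $A\in\Pi$, all $T_k$ are $\mathrm P_{A,\boldsymbol\theta}$-a.s. finite for every $\boldsymbol\theta\in\boldsymbol\Theta_A$, $\sup_{\boldsymbol\theta\in\boldsymbol\Theta_A}\mathrm P_{A,\boldsymbol\theta}(\mathbf D\setminus A\ne\emptyset)\le\alpha$ and $\sup_{\boldsymbol\theta\in\boldsymbol\Theta_A}\mathrm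 P_{A,\boldsymbol\theta}(A\setminus\mathbf D\ne\emptyset)\le\beta$. The parallel SPRT $\tilde\chi$ with thresholds $a,b>0$ is $\tilde T_k=\inf\{n\ge1:\lambda_k^*(n)\notin(-b,a)\}$, $\tilde D_k=\mathbf 1\{\lambda_k^*(\tilde T_k)\ge a\}$. **Assumptions.** For every $k$ and $\theta,u\in\Theta_k$ there is a number $I_k(\theta,u)>0$ with $\mathrm P_{k,\theta}\big(\limsup_n\frac{\ell_k(n,\theta)-\ell_k(n,u)}n\le I_k(\theta,u)\big)=1$; one has $I_k(\theta):=\inf_{u\in\Theta_k^0}I_k(\theta,u)>0$ for $\theta\in\Theta_k^1$ and $J_k(\theta):=\inf_{u\in\Theta_k^1}I_k(\theta,u)>0$ for $\theta\in\Theta_k^0$; and for every $\epsilon>0$ $$\sum_{n\ge1}\mathrm P_{k,\theta}\Big(\tfrac{\ell_k^*(n)-\ell_k^0(n)}n\le I_k(\theta)-\epsilon\Big)<\infty\ (\theta\in\Theta_k^1),\qquad \sum_{n\ge1}\mathrm P_{k,\theta}\Big(\tfrac{\ell_k^*(n)-\ell_k^1(n)}n\le J_k(\theta)-\epsilon\Big)<\infty\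 (\theta\in\Theta_k^0).$$ **Theorem 7.2.** Suppose that the thresholds $a=a(\alpha,\beta)>0$ and $b=b(\alpha,\beta)>0$ are such that $\tilde\chi\in\Delta^*(\alpha,\beta,\Pi)$ for all $\alpha,\beta\in(0,1)$ and $a\sim|\log\alpha|$, $b\sim|\log\beta|$ as $\alpha,\beta\to0$. Then, as $\alpha,\beta\to0$, $$\mathrm E_{A,\boldsymbol\theta}[\tilde T_i]\sim\inf\{\mathrm E_{A,\boldsymbol\theta}[T_i]:\chi\in\Delta'\cap\Delta^*(\alpha,\beta,\Pi)\}\sim\frac{|\log\alpha|}{I_i(\theta_i)},$$ $$\mathrm E_{A,\boldsymbol\theta}[\tilde T_j]\sim\inf\{\mathrm E_{A,\boldsymbol\theta}[T_j]:\chi\in\Delta'\cap\Delta^*(\alpha,\beta,\Pi)\}\sim\frac{|\log\beta|}{J_j(\theta_j)},$$ for every $A\in\Pi$, $i\in A$, $j\notin A$ and $\boldsymbol\theta\in\boldsymbol\Theta_A$. Moreover, the thresholds $a=|\log\alpha|+\max_{A\in\Pi}\log|A^c|$ and $b=|\log\beta|+\max_{A\in\Pi}\log|A|$ satisfy these requirements.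 -/

import Mathlib

open MeasureTheory ProbabilityTheory Filter Topology
open scoped ENNReal

namespace SeqTest

/-- The first `n` entries of an infinite sequence of observations. Entry `t` of the sequence is the
`(t+1)`-st observation, so this is the sample available at time `n`. -/
def pre {X : Type*} (n : ℕ) (x : ℕ → X) : Fin n → X := fun t => x t

/-- One data stream with observations in `X`: a parametric family of laws of the whole stream,
indexed by a subset of a Euclidean space, two composite hypotheses, and the log-likelihood function.

`ref n` is a sigma-finite measure on samples of size `n` that dominates all the laws, and
`exp (loglik n θ)` is a version of the density of the first `n` observations. As the
log-likelihood gets maximized over `θ` and evaluated at random `θ`, versions have to be fixed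
(jointly measurably in parameter and sample): for each single `θ` the identity in `loglik_step`
holds almost everywhere anyway, and the field asks that the exceptional set does not depend
on `θ`. -/
structure DataStream (X : Type*) [MeasurableSpace X] where
  /-- dimension of the Euclidean space that contains the parameters -/
  dim : ℕ
  /-- the parameter space -/
  param : Set (EuclideanSpace ℝ (Fin dim))
  /-- the parameters of the null hypothesis -/
  null : Set param
  /-- the parameters of the alternative hypothesis -/
  alt : Set param
  null_nonempty : null.Nonempty
  alt_nonempty : alt.Nonempty
  disjoint : Disjoint null alt
  /-- the distribution of the stream -/
  law : param → Measure (ℕ → X)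
  law_prob : ∀ θ, IsProbabilityMeasure (law θ)
  /-- the dominating measure for samples of size `n` -/
  ref : (n : ℕ) → Measure (Fin n → X)
  ref_sigmaFinite : ∀ n, SigmaFinite (ref n)
  /-- the dominating measure for the next observation given the first `n` observations -/
  refStep : (n : ℕ) → Kernel (Fin n → X) X
  refStep_sFinite : ∀ n, IsSFiniteKernel (refStep n)
  ref_succ : ∀ n, ref (n + 1) =
    (ref n ⊗ₘ refStep n).map
      (fun p : (Fin n → X) × X => (Fin.snoc (α := fun _ => X) p.1 p.2 : Fin (n + 1) → X))
  /-- the log-likelihood of a sample of size `n` -/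
  loglik : (n : ℕ) → param → (Fin n → X) → ℝ
  loglik_zero : ∀ θ h, loglik 0 θ h = 0
  loglik_measurable : ∀ n, Measurable (fun p : param × (Fin n → X) => loglik n p.1 p.2)
  loglik_density : ∀ n θ, (law θ).map (pre n) =
    (ref n).withDensity (fun h => ENNReal.ofReal (Real.exp (loglik n θ h)))
  loglik_step : ∀ n, ∀ᵐ h ∂ref n, ∀ θ,
    ∫⁻ z, ENNReal.ofReal (Real.exp (loglik (n + 1) θ (Fin.snoc (α := fun _ => X) h z)))
        ∂(refStep n h) =
      ENNReal.ofReal (Real.exp (loglik n θ h))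
  /-- the two maximum log-likelihoods are random variables -/
  sup_null_measurable :
    ∀ n, Measurable (fun h : Fin n → X => ⨆ θ ∈ null, (loglik n θ h : EReal))
  sup_alt_measurable :
    ∀ n, Measurable (fun h : Fin n → X => ⨆ θ ∈ alt, (loglik n θ h : EReal))

/-- Estimators `est n` of the parameter of a stream, each a function of the first `n` observations
of that same stream; `est 0` is a deterministic parameter. -/
structure Estimator {X : Type*} [MeasurableSpace X] (S : DataStream X) where
  est : (n : ℕ) → (Fin n → X) → S.param
  est_measurable : ∀ n, Measurable (est n)

namespace DataStream

variable {X : Type*} [MeasurableSpace X] (S : DataStream X)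

/-- The maximum log-likelihood at time `n` under the null hypothesis. -/
noncomputable def maxNull (n : ℕ) (x : ℕ → X) : EReal :=
  ⨆ θ ∈ S.null, (S.loglik n θ (pre n x) : EReal)

/-- The maximum log-likelihood at time `n` under the alternative hypothesis. -/
noncomputable def maxAlt (n : ℕ) (x : ℕ → X) : EReal :=
  ⨆ θ ∈ S.alt, (S.loglik n θ (pre n x) : EReal)

/-- The adaptive log-likelihood. -/
noncomputable def adaptive (E : Estimator S) : ℕ → (ℕ → X) → ℝ
  | 0, _ => 0
  | n + 1, x => adaptive E n x +
      (S.loglik (n + 1) (E.est n (pre n x)) (pre (n + 1) x) -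
        S.loglik n (E.est n (pre n x)) (pre n x))

/-- The adaptive log-likelihood ratio. -/
noncomputable def adaptiveLLR (E : Estimator S) (n : ℕ) (x : ℕ → X) : EReal :=
  if S.maxNull n x < min (S.maxAlt n x) (S.adaptive E n x : EReal) then
    (S.adaptive E n x : EReal) - S.maxNull n x
  else if S.maxAlt n x < min (S.maxNull n x) (S.adaptive E n x : EReal) then
    S.maxAlt n x - (S.adaptive E n x : EReal)
  else 0

/-- The numbers `I θ u` are positive and bound the growth rate of the log-likelihood ratio of `θ`
against `u` when `θ` is the true parameter. -/
def RateBound (I : S.param → S.param → ℝ) : Prop :=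
  ∀ θ u, 0 < I θ u ∧
    ∀ᵐ x ∂(S.law θ),
      limsup (fun n : ℕ =>
        (((S.loglik n θ (pre n x) - S.loglik n u (pre n x)) / (n : ℝ) : ℝ) : EReal)) atTop
        ≤ (I θ u : EReal)

/-- The smallest rate of `θ` against the null hypothesis. -/
noncomputable def rateNull (I : S.param → S.param → ℝ) (θ : S.param) : ℝ :=
  ⨅ u : S.null, I θ u

/-- The smallest rate of `θ` against the alternative hypothesis. -/
noncomputable def rateAlt (I : S.param → S.param → ℝ) (θ : S.param) : ℝ :=
  ⨅ u : S.alt, I θ u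

/-- The two hypotheses are separated. -/
def Separated (I : S.param → S.param → ℝ) : Prop :=
  (∀ θ ∈ S.alt, 0 < S.rateNull I θ) ∧ (∀ θ ∈ S.null, 0 < S.rateAlt I θ)

/-- One-sided complete convergence of the normalized adaptive statistics. The summation index `n`
stands for time `n + 1`. -/
def CompleteConvergence (E : Estimator S) (I : S.param → S.param → ℝ) : Prop :=
  (∀ θ ∈ S.alt, ∀ ε : ℝ, 0 < ε →
    ∑' n : ℕ, S.law θ {x | ((S.adaptive E (n + 1) x : EReal) - S.maxNull (n + 1) x) /
      ((n + 1 : ℕ) : EReal) ≤ ((S.rateNull I θ - ε : ℝ) : EReal)} < ∞) ∧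
  (∀ θ ∈ S.null, ∀ ε : ℝ, 0 < ε →
    ∑' n : ℕ, S.law θ {x | ((S.adaptive E (n + 1) x : EReal) - S.maxAlt (n + 1) x) /
      ((n + 1 : ℕ) : EReal) ≤ ((S.rateAlt I θ - ε : ℝ) : EReal)} < ∞)

end DataStream

section Multiple

variable {K : ℕ} {X : Fin K → Type*} [∀ k, MeasurableSpace (X k)]

/-- The sigma-algebra generated by the first `n` observations of stream `k`. -/
@[reducible] def streamSigma (X : Fin K → Type*) [∀ k, MeasurableSpace (X k)] (k : Fin K) (n : ℕ) :
    MeasurableSpace (∀ k, ℕ → X k) :=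
  ⨆ t : Fin n, MeasurableSpace.comap (fun ω : ∀ k, ℕ → X k => ω k t) inferInstance

/-- The sigma-algebra generated by the first `n` observations of all streams. -/
@[reducible] def allSigma (X : Fin K → Type*) [∀ k, MeasurableSpace (X k)] (n : ℕ) :
    MeasurableSpace (∀ k, ℕ → X k) :=
  ⨆ k : Fin K, streamSigma X k n

/-- Decision times and decisions, one for each stream, as functions of all the observations;
`dec k ω` means that stream `k` is identified as a signal. -/
structure Procedure (X : Fin K → Type*) where
  time : Fin K → (∀ k, ℕ → X k) → ℕ∞
  dec : Fin K → (∀ k, ℕ → X k) → Prop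

/-- The decision times are positive stopping times, and each decision is known at its decision
time, where the information at time `n` is `F k n` for the decision in stream `k`. -/
def Procedure.AdaptedTo (χ : Procedure X) (F : Fin K → ℕ → MeasurableSpace (∀ k, ℕ → X k)) :
    Prop :=
  ∀ k, (∀ ω, 1 ≤ χ.time k ω) ∧ MeasurableSet {ω | χ.dec k ω} ∧
    ∀ n : ℕ, MeasurableSet[F k n] {ω | χ.time k ω = n} ∧
      MeasurableSet[F k n] {ω | χ.time k ω = n ∧ χ.dec k ω} ∧
      MeasurableSet[F k n] {ω | χ.time k ω = n ∧ ¬ χ.dec k ω}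

/-- The family of all sequential multiple testing procedures. -/
def sequential (X : Fin K → Type*) [∀ k, MeasurableSpace (X k)] : Set (Procedure X) :=
  {χ | χ.AdaptedTo (fun _ n => allSigma X n)}

/-- The subfamily of decentralized procedures. -/
def decentralized (X : Fin K → Type*) [∀ k, MeasurableSpace (X k)] : Set (Procedure X) :=
  {χ | χ ∈ sequential X ∧ χ.AdaptedTo (fun k n => streamSigma X k n)}

/-- The parameters that are consistent with the subset of signals being `A`. -/
def consistent (S : ∀ k, DataStream (X k)) (A : Finset (Fin K)) : Set (∀ k, (S k).param) :=
  {θ | (∀ i ∈ A, θ i ∈ (S i).alt) ∧ ∀ j ∉ A, θ j ∈ (S j).null}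

/-- The joint distribution of the independent streams. -/
noncomputable def jointLaw (S : ∀ k, DataStream (X k)) (θ : ∀ k, (S k).param) :
    Measure (∀ k, ℕ → X k) :=
  Measure.pi (fun k => (S k).law (θ k))

/-- The expected decision time in stream `k`. -/
noncomputable def expTime (S : ∀ k, DataStream (X k)) (θ : ∀ k, (S k).param) (χ : Procedure X)
    (k : Fin K) : ℝ≥0∞ :=
  ∫⁻ ω, (χ.time k ω : ℝ≥0∞) ∂(jointLaw S θ)

/-- The sequential procedures that terminate almost surely and whose worst-case type-I and type-II
familywise error rates are at most `α` and `β` for every subset of signals in `prior`. -/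
def controlled (S : ∀ k, DataStream (X k)) (prior : Set (Finset (Fin K))) (α β : ℝ) :
    Set (Procedure X) :=
  {χ | χ ∈ sequential X ∧ ∀ A ∈ prior,
    (∀ θ ∈ consistent S A, ∀ k, ∀ᵐ ω ∂(jointLaw S θ), χ.time k ω < ⊤) ∧
    (⨆ θ ∈ consistent S A, jointLaw S θ {ω | ∃ j, j ∉ A ∧ χ.dec j ω}) ≤ ENNReal.ofReal α ∧
    (⨆ θ ∈ consistent S A, jointLaw S θ {ω | ∃ i, i ∈ A ∧ ¬ χ.dec i ω}) ≤ ENNReal.ofReal β}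

/-- The optimal expected decision time in stream `k` among decentralized procedures. -/
noncomputable def optTime (S : ∀ k, DataStream (X k)) (prior : Set (Finset (Fin K)))
    (θ : ∀ k, (S k).param) (k : Fin K) (α β : ℝ) : ℝ≥0∞ :=
  ⨅ χ ∈ decentralized X ∩ controlled S prior α β, expTime S θ χ k

/-- The first time `n ≥ 1` at which the adaptive log-likelihood ratio is outside `(-b, a)`. -/
noncomputable def sprtTime (S : ∀ k, DataStream (X k)) (E : ∀ k, Estimator (S k)) (a b : ℝ)
    (k : Fin K) (ω : ∀ k, ℕ → X k) : ℕ∞ :=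
  ⨅ (n : ℕ) (_ : 1 ≤ n ∧
    (S k).adaptiveLLR (E k) n (ω k) ∉ Set.Ioo ((-b : ℝ) : EReal) (a : EReal)), (n : ℕ∞)

/-- The parallel sequential probability ratio test with thresholds `a` and `b`, based on the
adaptive log-likelihood ratios: stream `k` is identified as a signal when its statistic is at
least `a` at the decision time. -/
noncomputable def sprt (S : ∀ k, DataStream (X k)) (E : ∀ k, Estimator (S k)) (a b : ℝ) :
    Procedure X where
  time := sprtTime S E a b
  dec k ω := ∃ n : ℕ, sprtTime S E a b k ω = n ∧
    (a : EReal) ≤ (S k).adaptiveLLR (E k) n (ω k)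

/-- Both error levels tend to zero, without any restriction on their relative speed. -/
def levels : Filter (ℝ × ℝ) := 𝓝[>] 0 ×ˢ 𝓝[>] 0

/-- `f ∼ g` as both error levels tend to zero. -/
def AsympEq (f g : ℝ → ℝ → ℝ≥0∞) : Prop :=
  Tendsto (fun p : ℝ × ℝ => f p.1 p.2 / g p.1 p.2) levels (𝓝 1)

/-- The thresholds are positive, the parallel test controls the error rates for all levels in
`(0, 1)`, and `a ∼ |log α|`, `b ∼ |log β|` as the levels tend to zero. -/
def SuitableThresholds (S : ∀ k, DataStream (X k)) (E : ∀ k, Estimator (S k))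
    (prior : Set (Finset (Fin K))) (a b : ℝ → ℝ → ℝ) : Prop :=
  (∀ α ∈ Set.Ioo (0 : ℝ) 1, ∀ β ∈ Set.Ioo (0 : ℝ) 1,
    0 < a α β ∧ 0 < b α β ∧ sprt S E (a α β) (b α β) ∈ controlled S prior α β) ∧
  Tendsto (fun p : ℝ × ℝ => a p.1 p.2 / |Real.log p.1|) levels (𝓝 1) ∧
  Tendsto (fun p : ℝ × ℝ => b p.1 p.2 / |Real.log p.2|) levels (𝓝 1)

end Multiple

end SeqTest

/-! Everything reduces to one stream at a time, with two one-sided estimates.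

Upper bound. The adaptive likelihood multiplies one-step predictive densities with the parameter
plugged in from the past, so its ratio to the likelihood of the true `θ` behaves as a nonnegative
martingale of mean at most one. Ville's inequality (`law_exists_exceed_le`) bounds by `exp (-a)` the
probability that the log-ratio ever reaches `a`. Since a supremum over a hypothesis containing `θ`
is at least the likelihood of `θ`, each single-stream error of the test is at most `exp (-a)` or
`exp (-b)`, and a union bound gives the explicit thresholds. For the decision time, fix `s` below
the rate. At any time `n ≥ a / s` the test has stopped, outside an event of summable probability:
complete convergence handles the size of the statistic, and Ville's inequality at level `s * n`
handles the required ordering of the two maximum likelihoods. Summing tails (`time_bound`) gives `E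
T ≤ a / s + const`.

Lower bound. In a decentralized procedure, the time and decision for stream `k` use stream `k` only,
so they form a test of `θ k` against any single parameter `u` of the opposite hypothesis, whatever
the other streams do. A change of measure (`jointLaw_time_le`) bounds the probability of stopping by
time `m` by the two errors, one multiplied by `exp c`, plus the probability that the log-likelihood
ratio exceeds `c` by time `m`. With `m` near `t * |log α|`, `t * I (θ k) u < 1` and `c` slightly
above `m * I (θ k) u`, all terms vanish, and Markov's inequality bounds the expected time from below
(`eventually_le_lintegral_time`). Choosing `u` nearly minimizing gives the rate of the upper bound.
-/

namespace SeqTest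

/-! ### Finite samples and their measurability -/

section Pre

variable {X : Type*} [MeasurableSpace X]

lemma measurable_pre (n : ℕ) : Measurable (pre n : (ℕ → X) → Fin n → X) :=
  measurable_pi_lambda _ fun t => measurable_pi_apply (t : ℕ)

lemma init_pre {X : Type*} (n : ℕ) (x : ℕ → X) :
    Fin.init (α := fun _ => X) (pre (n + 1) x) = pre n x := rfl

lemma measurable_init (n : ℕ) :
    Measurable (Fin.init (α := fun _ => X) : (Fin (n + 1) → X) → Fin n → X) :=
  measurable_pi_lambda _ fun t => measurable_pi_apply t.castSucc

lemma measurable_snoc (n : ℕ) :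
    Measurable (fun p : (Fin n → X) × X =>
      (Fin.snoc (α := fun _ => X) p.1 p.2 : Fin (n + 1) → X)) := by
  refine measurable_pi_lambda _ fun t => ?_
  refine Fin.lastCases ?_ (fun i => ?_) t
  · simpa using measurable_snd
  · simpa [Function.comp_def] using (measurable_pi_apply i).comp (measurable_fst (β := X))

end Pre

/-! ### The adaptive likelihood and Ville's inequality -/

namespace DataStream

variable {X : Type*} [MeasurableSpace X] (S : DataStream X)

instance (θ : S.param) : IsProbabilityMeasure (S.law θ) := S.law_prob θ
instance (n : ℕ) : SigmaFinite (S.ref n) := S.ref_sigmaFinite n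
instance (n : ℕ) : IsSFiniteKernel (S.refStep n) := S.refStep_sFinite n

/-- The adaptive log-likelihood as a function of the sample. -/
noncomputable def adaptiveFin (E : Estimator S) : (n : ℕ) → (Fin n → X) → ℝ
  | 0, _ => 0
  | n + 1, h => adaptiveFin E n (Fin.init (α := fun _ => X) h) +
      (S.loglik (n + 1) (E.est n (Fin.init (α := fun _ => X) h)) h -
        S.loglik n (E.est n (Fin.init (α := fun _ => X) h)) (Fin.init (α := fun _ => X) h))

lemma adaptive_eq (E : Estimator S) (n : ℕ) (x : ℕ → X) :
    S.adaptive E n x = S.adaptiveFin E n (pre n x) := by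
  induction n with
  | zero => rfl
  | succ n ih => simp only [adaptive, adaptiveFin, init_pre, ih]

lemma measurable_loglik (n : ℕ) (θ : S.param) : Measurable (S.loglik n θ) :=
  (S.loglik_measurable n).comp measurable_prodMk_left

lemma measurable_adaptiveFin (E : Estimator S) (n : ℕ) : Measurable (S.adaptiveFin E n) := by
  induction n with
  | zero => exact measurable_const
  | succ n ih =>
    have h1 := measurable_init (X := X) n
    have h2 := (E.est_measurable n).comp h1
    exact (ih.comp h1).add (((S.loglik_measurable (n + 1)).comp (h2.prodMk measurable_id)).sub
      ((S.loglik_measurable n).comp (h2.prodMk h1)))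

/-- The density of a sample of size `n`. -/
noncomputable def dens (n : ℕ) (θ : S.param) (h : Fin n → X) : ℝ≥0∞ :=
  ENNReal.ofReal (Real.exp (S.loglik n θ h))

lemma measurable_dens (n : ℕ) (θ : S.param) : Measurable (S.dens n θ) :=
  (Real.measurable_exp.comp (S.measurable_loglik n θ)).ennreal_ofReal

lemma law_pre (n : ℕ) (θ : S.param) {s : Set (Fin n → X)} (hs : MeasurableSet s) :
    S.law θ (pre n ⁻¹' s) = ∫⁻ h in s, S.dens n θ h ∂S.ref n := by
  rw [← Measure.map_apply (measurable_pre n) hs, S.loglik_density, withDensity_apply _ hs]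
  rfl

/-- The density of a sample of size `n` obtained by predicting each observation with the current
estimate of the parameter. -/
noncomputable def adaptiveDens (E : Estimator S) (n : ℕ) (h : Fin n → X) : ℝ≥0∞ :=
  ENNReal.ofReal (Real.exp (S.adaptiveFin E n h))

lemma measurable_adaptiveDens (E : Estimator S) (n : ℕ) : Measurable (S.adaptiveDens E n) :=
  (Real.measurable_exp.comp (S.measurable_adaptiveFin E n)).ennreal_ofReal

lemma lintegral_ref_succ (n : ℕ) {f : (Fin (n + 1) → X) → ℝ≥0∞} (hf : Measurable f) :
    ∫⁻ h, f h ∂S.ref (n + 1) =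
      ∫⁻ h, ∫⁻ z, f (Fin.snoc (α := fun _ => X) h z) ∂S.refStep n h ∂S.ref n := by
  rw [S.ref_succ, lintegral_map hf (measurable_snoc n),
    Measure.lintegral_compProd (f := fun p => f (Fin.snoc (α := fun _ => X) p.1 p.2))
      (hf.comp (measurable_snoc n))]

/-- Given the past `h`, the estimate is a fixed parameter, so the new factor is a ratio of
likelihoods of that parameter and integrates to one. The parameter varies with `h`, which is why the
exceptional null set in `loglik_step` must be common to all parameters. -/
lemma ae_lintegral_adaptiveDens (E : Estimator S) (n : ℕ) :
    ∀ᵐ h ∂S.ref n, ∫⁻ z, S.adaptiveDens E (n + 1) (Fin.snoc (α := fun _ => X) h z)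
      ∂S.refStep n h = S.adaptiveDens E n h := by
  filter_upwards [S.loglik_step n] with h hh
  have key : ∀ z, S.adaptiveDens E (n + 1) (Fin.snoc (α := fun _ => X) h z) =
      ENNReal.ofReal (Real.exp (S.adaptiveFin E n h - S.loglik n (E.est n h) h)) *
        S.dens (n + 1) (E.est n h) (Fin.snoc (α := fun _ => X) h z) := by
    intro z
    rw [adaptiveDens, dens, ← ENNReal.ofReal_mul (Real.exp_nonneg _), ← Real.exp_add]
    simp only [adaptiveFin, Fin.init_snoc]
    congr 2
    ring
  have hm : Measurable fun z => S.dens (n + 1) (E.est n h) (Fin.snoc (α := fun _ => X) h z) :=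
    (S.measurable_dens _ _).comp ((measurable_snoc n).comp measurable_prodMk_left)
  simp only [key]
  rw [lintegral_const_mul _ hm]
  simp only [dens]
  rw [hh, ← ENNReal.ofReal_mul (Real.exp_nonneg _), ← Real.exp_add, adaptiveDens]
  congr 2
  ring

/-- Consistency of the adaptive densities: a further observation does not change the mass of an
event of the first `n`. This plays the role of the martingale property. -/
lemma setLIntegral_adaptiveDens_succ (E : Estimator S) (n : ℕ) {s : Set (Fin n → X)}
    (hs : MeasurableSet s) :
    ∫⁻ h in Fin.init (α := fun _ => X) ⁻¹' s, S.adaptiveDens E (n + 1) h ∂S.ref (n + 1) =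
      ∫⁻ h in s, S.adaptiveDens E n h ∂S.ref n := by
  rw [← lintegral_indicator (measurable_init n hs), ← lintegral_indicator hs,
    S.lintegral_ref_succ n ((S.measurable_adaptiveDens E _).indicator (measurable_init n hs))]
  refine lintegral_congr_ae ?_
  filter_upwards [S.ae_lintegral_adaptiveDens E n] with h hh
  by_cases hmem : h ∈ s
  · rw [Set.indicator_of_mem hmem, ← hh]
    refine lintegral_congr fun z => Set.indicator_of_mem ?_ _
    simpa using hmem
  · rw [Set.indicator_of_notMem hmem, ← lintegral_zero]
    refine lintegral_congr fun z => Set.indicator_of_notMem ?_ _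
    simpa using hmem

/-- The event that the adaptive log-likelihood exceeds that of `θ` by `a` at some time up to `n`,
as a set of samples. -/
def crossed (E : Estimator S) (θ : S.param) (a : ℝ) : (n : ℕ) → Set (Fin n → X)
  | 0 => {h | a ≤ S.adaptiveFin E 0 h - S.loglik 0 θ h}
  | n + 1 => Fin.init (α := fun _ => X) ⁻¹' crossed E θ a n ∪
      {h | a ≤ S.adaptiveFin E (n + 1) h - S.loglik (n + 1) θ h}

lemma measurableSet_exceed (E : Estimator S) (θ : S.param) (a : ℝ) (n : ℕ) :
    MeasurableSet {h | a ≤ S.adaptiveFin E n h - S.loglik n θ h} :=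
  measurableSet_le measurable_const ((S.measurable_adaptiveFin E n).sub (S.measurable_loglik n θ))

lemma measurableSet_crossed (E : Estimator S) (θ : S.param) (a : ℝ) (n : ℕ) :
    MeasurableSet (S.crossed E θ a n) := by
  induction n with
  | zero => exact S.measurableSet_exceed E θ a 0
  | succ n ih => exact (measurable_init n ih).union (S.measurableSet_exceed E θ a (n + 1))

lemma mul_dens_le (E : Estimator S) (θ : S.param) (a : ℝ) (n : ℕ) {s : Set (Fin n → X)}
    (hs : MeasurableSet s) (h : s ⊆ {h | a ≤ S.adaptiveFin E n h - S.loglik n θ h}) :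
    ENNReal.ofReal (Real.exp a) * S.law θ (pre n ⁻¹' s) ≤
      ∫⁻ h in s, S.adaptiveDens E n h ∂S.ref n := by
  rw [S.law_pre n θ hs, ← lintegral_const_mul _ (S.measurable_dens n θ)]
  refine setLIntegral_mono (S.measurable_adaptiveDens E n) fun x hx => ?_
  rw [dens, adaptiveDens, ← ENNReal.ofReal_mul (Real.exp_nonneg _), ← Real.exp_add]
  refine ENNReal.ofReal_le_ofReal (Real.exp_le_exp.2 ?_)
  have := h hx
  simp only [Set.mem_ofPred_eq] at this
  linarith

/-- The adaptive mass is one at time 0 and is conserved. At a first crossing the adaptive density is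
at least `exp a` times that of `θ`, so the mass of the samples that cross pays for `exp a` times
their probability. Keeping the mass not yet crossed on the left makes the induction close. -/
lemma crossed_bound (E : Estimator S) (θ : S.param) (a : ℝ) (n : ℕ) :
    ENNReal.ofReal (Real.exp a) * S.law θ (pre n ⁻¹' S.crossed E θ a n) +
      ∫⁻ h in (S.crossed E θ a n)ᶜ, S.adaptiveDens E n h ∂S.ref n ≤ 1 := by
  induction n with
  | zero =>
    have hm := S.measurableSet_crossed E θ a 0
    refine (add_le_add_left (S.mul_dens_le E θ a 0 hm subset_rfl) _).trans ?_
    rw [lintegral_add_compl _ hm]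
    have h1 : ∫⁻ h, S.adaptiveDens E 0 h ∂S.ref 0 = ∫⁻ h, S.dens 0 θ h ∂S.ref 0 := by
      refine lintegral_congr fun h => ?_
      simp [adaptiveDens, dens, adaptiveFin, S.loglik_zero]
    rw [h1, ← setLIntegral_univ, ← S.law_pre 0 θ MeasurableSet.univ]
    exact prob_le_one
  | succ n ih =>
    set C := S.crossed E θ a n with hC
    set C' := S.crossed E θ a (n + 1) with hC'
    have hm : MeasurableSet C := S.measurableSet_crossed E θ a n
    have hm' : MeasurableSet C' := S.measurableSet_crossed E θ a (n + 1)
    have hi : MeasurableSet (Fin.init (α := fun _ => X) ⁻¹' C) := measurable_init n hm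
    have hdec : C' = Fin.init (α := fun _ => X) ⁻¹' C ∪ (C' \ Fin.init (α := fun _ => X) ⁻¹' C) :=
      (Set.union_sdiff_cancel Set.subset_union_left).symm
    have h1 : S.law θ (pre (n + 1) ⁻¹' C') ≤ S.law θ (pre n ⁻¹' C) +
        S.law θ (pre (n + 1) ⁻¹' (C' \ Fin.init (α := fun _ => X) ⁻¹' C)) := by
      conv_lhs => rw [hdec, Set.preimage_union]
      exact measure_union_le _ _
    have h2 := S.mul_dens_le E θ a (n + 1) (hm'.diff hi) (by
      rintro h ⟨h1 | h1, h2⟩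
      · exact absurd h1 h2
      · exact h1)
    -- The mass not crossed by time `n` splits into first crossings at `n + 1` and paths still not
    -- crossed.
    have h3 : ∫⁻ h in C' \ Fin.init (α := fun _ => X) ⁻¹' C, S.adaptiveDens E (n + 1) h
          ∂S.ref (n + 1) + ∫⁻ h in C'ᶜ, S.adaptiveDens E (n + 1) h ∂S.ref (n + 1) =
        ∫⁻ h in Cᶜ, S.adaptiveDens E n h ∂S.ref n := by
      rw [← S.setLIntegral_adaptiveDens_succ E n hm.compl, ← lintegral_union hm'.compl]
      · congr 2
        ext h
        have : h ∈ Fin.init (α := fun _ => X) ⁻¹' C → h ∈ C' := fun hh => Or.inl hh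
        simp only [Set.mem_union, Set.mem_sdiff, Set.mem_compl_iff, Set.preimage_compl]
        tauto
      · exact Set.disjoint_left.2 fun h h1 h2 => h2 h1.1
    calc _ ≤ ENNReal.ofReal (Real.exp a) * (S.law θ (pre n ⁻¹' C) +
          S.law θ (pre (n + 1) ⁻¹' (C' \ Fin.init (α := fun _ => X) ⁻¹' C))) +
          ∫⁻ h in C'ᶜ, S.adaptiveDens E (n + 1) h ∂S.ref (n + 1) := by gcongr
      _ ≤ ENNReal.ofReal (Real.exp a) * S.law θ (pre n ⁻¹' C) +
          (∫⁻ h in C' \ Fin.init (α := fun _ => X) ⁻¹' C, S.adaptiveDens E (n + 1) h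
          ∂S.ref (n + 1) + ∫⁻ h in C'ᶜ, S.adaptiveDens E (n + 1) h ∂S.ref (n + 1)) := by
        rw [mul_add, add_assoc]
        gcongr
      _ ≤ 1 := by rw [h3]; exact ih

lemma mem_crossed_iff (E : Estimator S) (θ : S.param) (a : ℝ) (n : ℕ) (x : ℕ → X) :
    pre n x ∈ S.crossed E θ a n ↔
      ∃ m ≤ n, a ≤ S.adaptive E m x - S.loglik m θ (pre m x) := by
  induction n with
  | zero => simp [crossed, adaptive_eq]
  | succ n ih =>
    simp only [crossed, Set.mem_union, Set.mem_preimage, init_pre, ih, Set.mem_ofPred_eq,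
      ← adaptive_eq]
    constructor
    · rintro (⟨m, hm, h⟩ | h)
      · exact ⟨m, by omega, h⟩
      · exact ⟨n + 1, le_rfl, h⟩
    · rintro ⟨m, hm, h⟩
      rcases Nat.le_succ_iff.1 hm with h1 | rfl
      · exact Or.inl ⟨m, h1, h⟩
      · exact Or.inr h

/-- Ville's inequality for the adaptive likelihood ratio. -/
theorem law_exists_exceed_le (E : Estimator S) (θ : S.param) (a : ℝ) :
    S.law θ {x | ∃ n, a ≤ S.adaptive E n x - S.loglik n θ (pre n x)} ≤
      ENNReal.ofReal (Real.exp (-a)) := by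
  have hU : {x | ∃ n, a ≤ S.adaptive E n x - S.loglik n θ (pre n x)} =
      ⋃ n, pre n ⁻¹' S.crossed E θ a n := by
    ext x
    simp only [Set.mem_ofPred_eq, Set.mem_iUnion, Set.mem_preimage, mem_crossed_iff]
    exact ⟨fun ⟨n, h⟩ => ⟨n, n, le_rfl, h⟩, fun ⟨_, m, _, h⟩ => ⟨m, h⟩⟩
  have hmono : Monotone fun n => (pre n ⁻¹' S.crossed E θ a n : Set (ℕ → X)) := by
    intro m n hmn x
    simp only [Set.mem_preimage, mem_crossed_iff]
    exact fun ⟨k, hk, h⟩ => ⟨k, hk.trans hmn, h⟩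
  rw [hU, hmono.measure_iUnion]
  refine iSup_le fun n => ?_
  have h := (le_add_right le_rfl).trans (S.crossed_bound E θ a n)
  rw [Real.exp_neg, ENNReal.ofReal_inv_of_pos (Real.exp_pos a), ENNReal.le_inv_iff_mul_le, mul_comm]
  exact h

end DataStream

end SeqTest

/-! ### One-sided events of the adaptive log-likelihood ratio -/

namespace SeqTest

namespace DataStream

variable {X : Type*} [MeasurableSpace X] (S : DataStream X)

/-- The maximum log-likelihood at time `n` over a set of parameters. -/
noncomputable def supLik (Q : Set S.param) (n : ℕ) (x : ℕ → X) : EReal :=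
  ⨆ θ ∈ Q, (S.loglik n θ (pre n x) : EReal)

lemma loglik_le_supLik {Q : Set S.param} {θ : S.param} (hθ : θ ∈ Q) (n : ℕ) (x : ℕ → X) :
    (S.loglik n θ (pre n x) : EReal) ≤ S.supLik Q n x :=
  le_iSup₂_of_le θ hθ le_rfl

/-- The adaptive log-likelihood ratio of the hypothesis `R` against `Q` is at least `a`. -/
def Favors (E : Estimator S) (Q R : Set S.param) (a : ℝ) (n : ℕ) (x : ℕ → X) : Prop :=
  S.supLik Q n x < S.supLik R n x ∧ (a : EReal) ≤ (S.adaptive E n x : EReal) - S.supLik Q n x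

variable {S}

/-- A positive threshold can be reached only in the first branch of the definition, and reaching it
already forces the adaptive likelihood above the null maximum. With the mirror statement
`adaptiveLLR_le_iff`, both hypotheses can be treated by the same arguments about `Favors`. -/
lemma le_adaptiveLLR_iff (E : Estimator S) {a : ℝ} (ha : 0 < a) (n : ℕ) (x : ℕ → X) :
    (a : EReal) ≤ S.adaptiveLLR E n x ↔ S.Favors E S.null S.alt a n x := by
  have ha' : (0 : EReal) < a := by exact_mod_cast ha
  change _ ↔ S.maxNull n x < S.maxAlt n x ∧ _ ≤ _ - S.maxNull n x
  have h1 : (a : EReal) ≤ (S.adaptive E n x : EReal) - S.maxNull n x →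
      S.maxNull n x < S.adaptive E n x := fun h => EReal.sub_pos.1 (ha'.trans_le h)
  unfold adaptiveLLR
  split_ifs with h2 h3
  · simp only [lt_min_iff] at h2
    tauto
  · simp only [lt_min_iff] at h2 h3
    have : S.maxAlt n x - (S.adaptive E n x : EReal) < 0 := (EReal.sub_neg (by simp) (by simp)).2 h3.2
    have h4 : ¬ ((a : EReal) ≤ S.maxAlt n x - (S.adaptive E n x : EReal)) :=
      fun h => absurd (ha'.trans_le h) this.not_gt
    tauto
  · simp only [lt_min_iff] at h2
    have h4 : ¬ ((a : EReal) ≤ 0) := ha'.not_ge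
    tauto

lemma adaptiveLLR_le_iff (E : Estimator S) {b : ℝ} (hb : 0 < b) (n : ℕ) (x : ℕ → X) :
    S.adaptiveLLR E n x ≤ ((-b : ℝ) : EReal) ↔ S.Favors E S.alt S.null b n x := by
  have hb' : (0 : EReal) < b := by exact_mod_cast hb
  change _ ↔ S.maxAlt n x < S.maxNull n x ∧ _ ≤ _ - S.maxAlt n x
  have h1 : (b : EReal) ≤ (S.adaptive E n x : EReal) - S.maxAlt n x →
      S.maxAlt n x < S.adaptive E n x := fun h => EReal.sub_pos.1 (hb'.trans_le h)
  have h5 : ((-b : ℝ) : EReal) < 0 := by exact_mod_cast neg_lt_zero.2 hb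
  unfold adaptiveLLR
  split_ifs with h2 h3
  · simp only [lt_min_iff] at h2
    have : 0 < (S.adaptive E n x : EReal) - S.maxNull n x := EReal.sub_pos.2 h2.2
    have h4 : ¬ ((S.adaptive E n x : EReal) - S.maxNull n x ≤ ((-b : ℝ) : EReal)) :=
      fun h => absurd (this.trans_le h) h5.not_gt
    have := h2.1.not_gt
    tauto
  · simp only [lt_min_iff] at h3
    rw [EReal.coe_neg, EReal.le_neg, EReal.neg_sub (by simp) (by simp), add_comm, ← sub_eq_add_neg]
    tauto
  · simp only [lt_min_iff] at h3
    have h4 : ¬ ((0 : EReal) ≤ ((-b : ℝ) : EReal)) := h5.not_ge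
    tauto

/-- Under each parameter of `Q` it is unlikely that `R` is ever favored. -/
lemma law_exists_favors_le (E : Estimator S) {Q : Set S.param} (R : Set S.param) {θ : S.param}
    (hθ : θ ∈ Q) (a : ℝ) :
    S.law θ {x | ∃ n, S.Favors E Q R a n x} ≤ ENNReal.ofReal (Real.exp (-a)) := by
  refine (measure_mono ?_).trans (S.law_exists_exceed_le E θ a)
  rintro x ⟨n, -, h⟩
  refine ⟨n, ?_⟩
  have := h.trans (EReal.sub_le_sub le_rfl (S.loglik_le_supLik hθ n x))
  exact_mod_cast this

/-- Complete convergence at rate `r` makes the failure to favor `R` summable below rate `r`. -/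
lemma exists_summable_not_favors (E : Estimator S) {Q R : Set S.param} {θ : S.param} (hθ : θ ∈ R)
    {r s : ℝ} (hs : 0 < s) (hsr : s < r)
    (hc : ∀ ε : ℝ, 0 < ε → ∑' n : ℕ, S.law θ {x | ((S.adaptive E (n + 1) x : EReal) -
      S.supLik Q (n + 1) x) / ((n + 1 : ℕ) : EReal) ≤ ((r - ε : ℝ) : EReal)} < ∞) :
    ∃ p : ℕ → ℝ≥0∞, ∑' n, p n < ∞ ∧ ∀ (a : ℝ) (n : ℕ), a ≤ s * (n + 1) →
      S.law θ {x | ¬ S.Favors E Q R a (n + 1) x} ≤ p n := by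
  -- The first term is the failure of complete convergence with `ε = r - s`; the second is Ville's
  -- bound at level `s * (n + 1)`.
  refine ⟨fun n => S.law θ {x | ((S.adaptive E (n + 1) x : EReal) -
      S.supLik Q (n + 1) x) / ((n + 1 : ℕ) : EReal) ≤ (s : EReal)} +
      ENNReal.ofReal (Real.exp (-(s * (n + 1)))), ?_, ?_⟩
  · rw [ENNReal.tsum_add]
    refine ENNReal.add_lt_top.2 ⟨?_, ?_⟩
    · have h := hc (r - s) (sub_pos.2 hsr)
      rwa [sub_sub_cancel] at h
    · have hsum : Summable fun n : ℕ => Real.exp (-(s * (n + 1))) := by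
        have h := (Real.summable_exp_nat_mul_iff.2 (neg_lt_zero.2 hs)).mul_right (Real.exp (-s))
        refine h.congr fun n => ?_
        rw [← Real.exp_add]
        congr 1
        ring
      rw [← ENNReal.ofReal_tsum_of_nonneg (fun n => (Real.exp_pos _).le) hsum]
      exact ENNReal.ofReal_lt_top
  · intro a n ha
    refine (measure_mono (t := {x | ((S.adaptive E (n + 1) x : EReal) -
      S.supLik Q (n + 1) x) / ((n + 1 : ℕ) : EReal) ≤ (s : EReal)} ∪
      {x | ∃ m, s * (n + 1) ≤ S.adaptive E m x - S.loglik m θ (pre m x)}) ?_).trans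
      ((measure_union_le _ _).trans (add_le_add_right (S.law_exists_exceed_le E θ _) _))
    intro x hx
    by_contra hcon
    refine hx ?_
    simp only [Set.mem_union, Set.mem_ofPred_eq, not_or, not_exists, not_le] at hcon
    obtain ⟨h1, h2⟩ := hcon
    have h2 := h2 (n + 1)
    have hpos : (0 : EReal) < ((n + 1 : ℕ) : EReal) := by exact_mod_cast Nat.succ_pos n
    rw [EReal.lt_div_iff hpos (EReal.natCast_ne_top _)] at h1
    have hcast : (s : EReal) * ((n + 1 : ℕ) : EReal) = ((s * (n + 1) : ℝ) : EReal) := by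
      push_cast
      rfl
    rw [hcast] at h1
    -- Off both bad events, the maximum over `Q` is below the adaptive likelihood minus `s * (n +
    -- 1)`, which is below the likelihood of `θ`, hence below the maximum over `R`.
    refine ⟨lt_of_lt_of_le ?_ (S.loglik_le_supLik hθ (n + 1) x), le_trans ?_ h1.le⟩
    · have h3 := EReal.add_lt_of_lt_sub h1
      generalize S.supLik Q (n + 1) x = y at h3 ⊢
      rw [show (n : ℝ) + 1 = ((n + 1 : ℕ) : ℝ) by push_cast; rfl] at h2 h3
      generalize s * ((n + 1 : ℕ) : ℝ) = c at h2 h3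
      induction y with
      | bot => exact EReal.bot_lt_coe _
      | top => simp at h3
      | coe y =>
        have h3 : c + y < S.adaptive E (n + 1) x := by exact_mod_cast h3
        rw [EReal.coe_lt_coe_iff]
        linarith
    · exact_mod_cast ha

variable (S)

/-- The information in the first `n` observations. -/
abbrev preSigma (X : Type*) [MeasurableSpace X] (n : ℕ) : MeasurableSpace (ℕ → X) :=
  MeasurableSpace.comap (pre n) inferInstance

lemma measurable_preSigma_pre (n : ℕ) : Measurable[preSigma X n] (pre n : (ℕ → X) → Fin n → X) :=
  comap_measurable _

lemma measurable_preSigma_adaptive (E : Estimator S) (n : ℕ) :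
    Measurable[preSigma X n] (S.adaptive E n) := by
  have : S.adaptive E n = S.adaptiveFin E n ∘ pre n := funext fun x => S.adaptive_eq E n x
  rw [this]
  exact (S.measurable_adaptiveFin E n).comp (measurable_preSigma_pre n)

lemma measurable_preSigma_adaptiveLLR (E : Estimator S) (n : ℕ) :
    Measurable[preSigma X n] (S.adaptiveLLR E n) := by
  have h0 : Measurable[preSigma X n] (S.maxNull n) :=
    (S.sup_null_measurable n).comp (measurable_preSigma_pre n)
  have h1 : Measurable[preSigma X n] (S.maxAlt n) :=
    (S.sup_alt_measurable n).comp (measurable_preSigma_pre n)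
  have h2 : Measurable[preSigma X n] fun x => (S.adaptive E n x : EReal) :=
    measurable_coe_real_ereal.comp (S.measurable_preSigma_adaptive E n)
  unfold adaptiveLLR
  refine Measurable.ite (measurableSet_lt h0 (h1.min h2)) (h2.add h0.neg) ?_
  exact Measurable.ite (measurableSet_lt h1 (h0.min h2)) (h1.add h2.neg) measurable_const

end DataStream

/-! ### The parallel test is a decentralized procedure -/

section Sprt

lemma iInf_natCast_eq_iff (P : ℕ → Prop) (m : ℕ) :
    (⨅ (n : ℕ) (_ : P n), (n : ℕ∞)) = m ↔ P m ∧ ∀ j < m, ¬ P j := by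
  classical
  by_cases h : ∃ n, P n
  · have hf : (⨅ (n : ℕ) (_ : P n), (n : ℕ∞)) = (Nat.find h : ℕ) :=
      le_antisymm (iInf₂_le _ (Nat.find_spec h))
        (le_iInf₂ fun n hn => by exact_mod_cast Nat.find_min' h hn)
    rw [hf, Nat.cast_inj, Nat.find_eq_iff]
  · have hf : (⨅ (n : ℕ) (_ : P n), (n : ℕ∞)) = ⊤ :=
      iInf₂_eq_top.2 fun n hn => absurd ⟨n, hn⟩ h
    rw [hf]
    refine ⟨fun h' => absurd h' (ENat.top_ne_natCast m), fun h' => absurd ⟨m, h'.1⟩ h⟩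

variable {K : ℕ} {X : Fin K → Type*} [∀ k, MeasurableSpace (X k)]

/-- Presents each event known at time `n` as the preimage of a set of samples, the form needed for
the change of measure. -/
lemma streamSigma_eq (k : Fin K) (n : ℕ) :
    streamSigma X k n = MeasurableSpace.comap (fun ω => pre n (ω k)) inferInstance := by
  simp only [streamSigma, MeasurableSpace.pi, MeasurableSpace.comap_iSup,
    MeasurableSpace.comap_comp]
  rfl

lemma streamSigma_mono (k : Fin K) {m n : ℕ} (h : m ≤ n) : streamSigma X k m ≤ streamSigma X k n :=
  iSup_le fun t => le_iSup_of_le (⟨t, t.2.trans_le h⟩ : Fin n) le_rfl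

lemma streamSigma_le_pi (k : Fin K) (n : ℕ) : streamSigma X k n ≤ MeasurableSpace.pi :=
  iSup_le fun t => Measurable.comap_le
    ((measurable_pi_apply (t : ℕ)).comp (measurable_pi_apply k))

lemma streamSigma_le_allSigma (k : Fin K) (n : ℕ) : streamSigma X k n ≤ allSigma X n :=
  le_iSup (fun k => streamSigma X k n) k

variable (S : ∀ k, DataStream (X k)) (E : ∀ k, Estimator (S k))

lemma sprtTime_eq_iff (a b : ℝ) (k : Fin K) (ω : ∀ k, ℕ → X k) (n : ℕ) :
    sprtTime S E a b k ω = n ↔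
      (1 ≤ n ∧ (S k).adaptiveLLR (E k) n (ω k) ∉ Set.Ioo ((-b : ℝ) : EReal) (a : EReal)) ∧
      ∀ j < n, ¬ (1 ≤ j ∧
        (S k).adaptiveLLR (E k) j (ω k) ∉ Set.Ioo ((-b : ℝ) : EReal) (a : EReal)) :=
  iInf_natCast_eq_iff _ n

lemma measurable_streamSigma_adaptiveLLR (k : Fin K) (n : ℕ) :
    Measurable[streamSigma X k n]
      (fun ω : ∀ k, ℕ → X k => (S k).adaptiveLLR (E k) n (ω k)) := by
  refine ((S k).measurable_preSigma_adaptiveLLR (E k) n).comp ?_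
  rw [streamSigma_eq]
  rw [measurable_comap_iff]
  exact comap_measurable _

lemma sprt_adaptedTo (a b : ℝ) :
    (sprt S E a b).AdaptedTo (fun k n => streamSigma X k n) := by
  intro k
  have hT : ∀ n : ℕ, MeasurableSet[streamSigma X k n] {ω | (sprt S E a b).time k ω = n} := by
    intro n
    have : {ω | (sprt S E a b).time k ω = n} =
        {ω | (1 ≤ n ∧
          (S k).adaptiveLLR (E k) n (ω k) ∉ Set.Ioo ((-b : ℝ) : EReal) (a : EReal)) ∧
        ∀ j < n, ¬ (1 ≤ j ∧
          (S k).adaptiveLLR (E k) j (ω k) ∉ Set.Ioo ((-b : ℝ) : EReal) (a : EReal))} := by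
      ext ω
      exact sprtTime_eq_iff S E a b k ω n
    rw [this]
    have hj : ∀ j ≤ n, MeasurableSet[streamSigma X k n] {ω | 1 ≤ j ∧
        (S k).adaptiveLLR (E k) j (ω k) ∉ Set.Ioo ((-b : ℝ) : EReal) (a : EReal)} := by
      intro j hj
      refine streamSigma_mono k hj _ ?_
      exact (MeasurableSet.const _).inter
        (measurable_streamSigma_adaptiveLLR S E k j measurableSet_Ioo).compl
    have hI : {ω : ∀ k, ℕ → X k | ∀ j < n, ¬ (1 ≤ j ∧
        (S k).adaptiveLLR (E k) j (ω k) ∉ Set.Ioo ((-b : ℝ) : EReal) (a : EReal))} =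
        ⋂ (j : ℕ) (_ : j < n), {ω | 1 ≤ j ∧
          (S k).adaptiveLLR (E k) j (ω k) ∉ Set.Ioo ((-b : ℝ) : EReal) (a : EReal)}ᶜ := by
      ext ω
      simp only [Set.mem_iInter, Set.mem_compl_iff, Set.mem_ofPred_eq]
    have hM : MeasurableSet[streamSigma X k n] {ω : ∀ k, ℕ → X k | ∀ j < n, ¬ (1 ≤ j ∧
        (S k).adaptiveLLR (E k) j (ω k) ∉ Set.Ioo ((-b : ℝ) : EReal) (a : EReal))} := by
      rw [hI]
      exact MeasurableSet.iInter fun j => MeasurableSet.iInter fun h => (hj j h.le).compl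
    exact (hj n le_rfl).inter hM
  have hD : ∀ n : ℕ, MeasurableSet[streamSigma X k n]
      {ω | (sprt S E a b).time k ω = n ∧ (sprt S E a b).dec k ω} := by
    intro n
    have : {ω | (sprt S E a b).time k ω = n ∧ (sprt S E a b).dec k ω} =
        {ω | (sprt S E a b).time k ω = n} ∩
          {ω | (a : EReal) ≤ (S k).adaptiveLLR (E k) n (ω k)} := by
      ext ω
      constructor
      · rintro ⟨h, m, hm, hle⟩
        have : (m : ℕ∞) = n := hm.symm.trans h
        rw [Nat.cast_inj] at this
        subst this
        exact ⟨h, hle⟩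
      · rintro ⟨h, hle⟩
        exact ⟨h, n, h, hle⟩
    rw [this]
    exact (hT n).inter (measurable_streamSigma_adaptiveLLR S E k n measurableSet_Ici)
  refine ⟨fun ω => le_iInf₂ fun n hn => by exact_mod_cast hn.1, ?_, fun n => ⟨hT n, hD n, ?_⟩⟩
  -- A positive decision presupposes a finite decision time, so a countable union suffices.
  · have : {ω | (sprt S E a b).dec k ω} =
        ⋃ n : ℕ, {ω | (sprt S E a b).time k ω = n ∧ (sprt S E a b).dec k ω} := by
      ext ω
      simp only [Set.mem_iUnion, Set.mem_ofPred_eq]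
      exact ⟨fun h => ⟨h.choose, h.choose_spec.1, h⟩, fun ⟨_, _, h⟩ => h⟩
    rw [this]
    exact MeasurableSet.iUnion fun n => streamSigma_le_pi k n _ (hD n)
  · have : {ω | (sprt S E a b).time k ω = n ∧ ¬ (sprt S E a b).dec k ω} =
        {ω | (sprt S E a b).time k ω = n} \
          {ω | (sprt S E a b).time k ω = n ∧ (sprt S E a b).dec k ω} := by
      ext ω
      simp only [Set.mem_sdiff, Set.mem_ofPred_eq]
      tauto
    rw [this]
    exact (hT n).diff (hD n)

lemma sprt_mem_decentralized (a b : ℝ) : sprt S E a b ∈ decentralized X := by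
  refine ⟨fun k => ?_, sprt_adaptedTo S E a b⟩
  obtain ⟨h1, h2, h3⟩ := sprt_adaptedTo S E a b k
  exact ⟨h1, h2, fun n => ⟨streamSigma_le_allSigma k n _ (h3 n).1,
    streamSigma_le_allSigma k n _ (h3 n).2.1, streamSigma_le_allSigma k n _ (h3 n).2.2⟩⟩

end Sprt

end SeqTest

/-! ### Expected decision times and error probabilities of the test -/

namespace SeqTest

lemma enat_eq_tsum (t : ℕ∞) :
    (t : ℝ≥0∞) = ∑' n : ℕ, if (n : ℕ∞) < t then (1 : ℝ≥0∞) else 0 := by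
  induction t using ENat.recTopCoe with
  | top => simp
  | coe m =>
    rw [tsum_eq_sum (s := Finset.range m)]
    · rw [Finset.sum_congr rfl fun n hn => if_pos (by exact_mod_cast Finset.mem_range.1 hn)]
      simp
    · intro n hn
      rw [if_neg]
      simpa using hn

section Time

variable {Ω : Type*} [MeasurableSpace Ω]

lemma measurableSet_time_le {T : Ω → ℕ∞} (hT : ∀ n : ℕ, MeasurableSet {ω | T ω = n}) (m : ℕ) :
    MeasurableSet {ω | T ω ≤ m} := by
  have : {ω | T ω ≤ m} = ⋃ n ∈ Finset.range (m + 1), {ω | T ω = n} := by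
    ext ω
    simp only [Set.mem_ofPred_eq, Set.mem_iUnion, Finset.mem_range, exists_prop]
    constructor
    · intro h
      lift T ω to ℕ using ne_top_of_le_ne_top (ENat.natCast_ne_top m) h with t
      exact ⟨t, by simpa [Nat.lt_succ_iff] using h, rfl⟩
    · rintro ⟨n, hn, h⟩
      rw [h]
      exact_mod_cast Nat.lt_succ_iff.1 hn
  rw [this]
  exact Finset.measurableSet_biUnion _ fun n _ => hT n

lemma measurableSet_lt_time {T : Ω → ℕ∞} (hT : ∀ n : ℕ, MeasurableSet {ω | T ω = n}) (m : ℕ) :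
    MeasurableSet {ω | (m : ℕ∞) < T ω} := by
  have : {ω | (m : ℕ∞) < T ω} = {ω | T ω ≤ m}ᶜ := by
    ext ω
    simp
  rw [this]
  exact (measurableSet_time_le hT m).compl

lemma lintegral_time {T : Ω → ℕ∞} (hT : ∀ n : ℕ, MeasurableSet {ω | T ω = n}) (μ : Measure Ω) :
    ∫⁻ ω, (T ω : ℝ≥0∞) ∂μ = ∑' n : ℕ, μ {ω | (n : ℕ∞) < T ω} := by
  simp_rw [enat_eq_tsum (T _)]
  rw [lintegral_tsum fun n => (Measurable.ite (measurableSet_lt_time hT n) measurable_const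
    measurable_const).aemeasurable]
  refine tsum_congr fun n => ?_
  rw [← lintegral_indicator_one (measurableSet_lt_time hT n)]
  refine lintegral_congr fun ω => ?_
  simp [Set.indicator_apply]

/-- Markov's inequality for an integer-valued time. The factor `m + 1` instead of `m` later
compensates for rounding `m` down. -/
lemma mul_measure_le_lintegral_time {T : Ω → ℕ∞} (hT : ∀ n : ℕ, MeasurableSet {ω | T ω = n})
    (μ : Measure Ω) (m : ℕ) :
    ((m + 1 : ℕ) : ℝ≥0∞) * μ {ω | (m : ℕ∞) < T ω} ≤ ∫⁻ ω, (T ω : ℝ≥0∞) ∂μ := by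
  rw [← lintegral_indicator_const (measurableSet_lt_time hT m)]
  refine lintegral_mono (Set.indicator_le' (g := fun ω => (T ω : ℝ≥0∞)) (fun ω h => ?_)
    fun _ _ => zero_le)
  have h : ((m + 1 : ℕ) : ℕ∞) ≤ T ω := by
    have := Order.add_one_le_of_lt (show (m : ℕ∞) < T ω from h)
    exact_mod_cast this
  have := ENat.toENNReal_le.2 h
  simpa using this

end Time

variable {K : ℕ} {X : Fin K → Type*} [∀ k, MeasurableSpace (X k)]

lemma measurableSet_time_eq {χ : Procedure X} (hχ : χ.AdaptedTo fun k n => streamSigma X k n)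
    (k : Fin K) (n : ℕ) : MeasurableSet {ω | χ.time k ω = n} :=
  streamSigma_le_pi k n _ ((hχ k).2.2 n).1

variable (S : ∀ k, DataStream (X k)) (E : ∀ k, Estimator (S k))

instance (θ : ∀ k, (S k).param) : IsProbabilityMeasure (jointLaw S θ) := by
  unfold jointLaw
  infer_instance

lemma map_jointLaw (θ : ∀ k, (S k).param) (k : Fin K) :
    (jointLaw S θ).map (fun ω => ω k) = (S k).law (θ k) :=
  (measurePreserving_eval (fun k => (S k).law (θ k)) k).map_eq

lemma jointLaw_preimage (θ : ∀ k, (S k).param) (k : Fin K) {s : Set (ℕ → X k)}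
    (hs : MeasurableSet s) : jointLaw S θ {ω | ω k ∈ s} = (S k).law (θ k) s := by
  rw [← map_jointLaw S θ k, Measure.map_apply (measurable_pi_apply k) hs]
  rfl

/-- The inequality, unlike the equality, needs no measurability of `s`; it is applied to events
involving `Favors` without checking theirs. -/
lemma jointLaw_preimage_le (θ : ∀ k, (S k).param) (k : Fin K) (s : Set (ℕ → X k)) :
    jointLaw S θ {ω | ω k ∈ s} ≤ (S k).law (θ k) s := by
  rw [← map_jointLaw S θ k]
  exact Measure.le_map_apply
    (measurable_pi_apply (X := fun k => ℕ → X k) k).aemeasurable s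

variable {S E}

/-- A decision time that comes no later than the first time at which `R` is favored is almost
surely finite and has a bounded expectation. -/
lemma time_bound {χ : Procedure X} (hχ : χ.AdaptedTo fun k n => streamSigma X k n) {k : Fin K}
    {Q R : Set (S k).param} {θ : ∀ k, (S k).param} {s : ℝ} (hs : 0 < s) {p : ℕ → ℝ≥0∞}
    (hp : ∑' n, p n < ∞)
    (hpF : ∀ (a : ℝ) (n : ℕ), a ≤ s * (n + 1) →
      (S k).law (θ k) {x | ¬ (S k).Favors (E k) Q R a (n + 1) x} ≤ p n)
    {a : ℝ} (ha : 0 < a)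
    (hT : ∀ (n : ℕ) ω, (S k).Favors (E k) Q R a (n + 1) (ω k) → χ.time k ω ≤ (n + 1 : ℕ)) :
    (∀ᵐ ω ∂jointLaw S θ, χ.time k ω < ⊤) ∧
      expTime S θ χ k ≤ ENNReal.ofReal (a / s) + (2 + ∑' n, p n) := by
  have hle : ∀ n : ℕ, a ≤ s * (n + 1) →
      jointLaw S θ {ω | ((n + 1 : ℕ) : ℕ∞) < χ.time k ω} ≤ p n := by
    intro n hn
    refine (measure_mono fun ω hω => ?_).trans
      ((jointLaw_preimage_le S θ k {x | ¬ (S k).Favors (E k) Q R a (n + 1) x}).trans (hpF a n hn))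
    exact fun h => (hT n ω h).not_gt hω
  have hlarge : ∀ n : ℕ, ⌈a / s⌉₊ ≤ n → a ≤ s * (n + 1) := by
    intro n hn
    have := Nat.ceil_le.1 hn
    rw [div_le_iff₀ hs] at this
    nlinarith
  constructor
  · rw [ae_iff]
    -- Never stopping is contained in every tail event, whose probabilities tend to zero.
    have h0 := ENNReal.tendsto_atTop_zero_of_tsum_ne_top hp.ne
    refine le_antisymm (ge_of_tendsto h0 ?_) zero_le
    filter_upwards [eventually_ge_atTop ⌈a / s⌉₊] with n hn
    refine (measure_mono fun ω hω => ?_).trans (hle n (hlarge n hn))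
    have hω : χ.time k ω = ⊤ := by simpa using hω
    simp only [Set.mem_ofPred_eq, hω]
    exact ENat.natCast_lt_top _
  -- Of the constant 2, one unit is the tail term at 0, split off here, and the other comes from
  -- rounding `a / s` up.
  · rw [expTime, lintegral_time (measurableSet_time_eq hχ k), tsum_eq_zero_add' ENNReal.summable]
    have hterm : ∀ n : ℕ, jointLaw S θ {ω | ((n + 1 : ℕ) : ℕ∞) < χ.time k ω} ≤
        (if (n : ℕ∞) < (⌈a / s⌉₊ : ℕ∞) then 1 else 0) + p n := by
      intro n
      split_ifs with h
      · exact prob_le_one.trans (le_add_right le_rfl)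
      · rw [zero_add]
        exact hle n (hlarge n (by simpa using h))
    calc _ ≤ 1 + ∑' n : ℕ, ((if (n : ℕ∞) < (⌈a / s⌉₊ : ℕ∞) then 1 else 0) + p n) :=
          add_le_add prob_le_one (ENNReal.tsum_le_tsum hterm)
      _ = 1 + (((⌈a / s⌉₊ : ℕ∞) : ℝ≥0∞) + ∑' n, p n) := by rw [ENNReal.tsum_add, ← enat_eq_tsum]
      _ ≤ 1 + ((ENNReal.ofReal (a / s) + 1) + ∑' n, p n) := by
          gcongr
          rw [← ENNReal.ofReal_one, ← ENNReal.ofReal_add (by positivity) zero_le_one,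
            ENat.toENNReal_coe, ← ENNReal.ofReal_natCast]
          exact ENNReal.ofReal_le_ofReal (Nat.ceil_lt_add_one (by positivity)).le
      _ = _ := by ring

lemma sprtTime_le {a b : ℝ} {k : Fin K} {ω : ∀ k, ℕ → X k} {n : ℕ}
    (h : (S k).adaptiveLLR (E k) (n + 1) (ω k) ∉ Set.Ioo ((-b : ℝ) : EReal) (a : EReal)) :
    (sprt S E a b).time k ω ≤ (n + 1 : ℕ) :=
  iInf₂_le (n + 1) ⟨by omega, h⟩

/-- Termination and expected decision time of the test in a stream with a signal. -/
lemma exists_sprt_bound_alt {I : ∀ k, (S k).param → (S k).param → ℝ} {k : Fin K}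
    (hconv : (S k).CompleteConvergence (E k) (I k)) {θ : ∀ k, (S k).param} (hθ : θ k ∈ (S k).alt)
    {s : ℝ} (hs : 0 < s) (hsr : s < (S k).rateNull (I k) (θ k)) :
    ∃ c : ℝ≥0∞, c < ∞ ∧ ∀ a b : ℝ, 0 < a → 0 < b →
      (∀ᵐ ω ∂jointLaw S θ, (sprt S E a b).time k ω < ⊤) ∧
      expTime S θ (sprt S E a b) k ≤ ENNReal.ofReal (a / s) + c := by
  obtain ⟨p, hp, hpF⟩ := DataStream.exists_summable_not_favors (E k) (Q := (S k).null) hθ hs hsr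
    (hconv.1 (θ k) hθ)
  refine ⟨2 + ∑' n, p n, ENNReal.add_lt_top.2 ⟨by simp, hp⟩, fun a b ha hb => ?_⟩
  refine time_bound (sprt_adaptedTo S E a b) hs hp hpF ha fun n ω h => sprtTime_le ?_
  rw [← DataStream.le_adaptiveLLR_iff (E k) ha] at h
  exact fun h' => h.not_gt h'.2

/-- Termination and expected decision time of the test in a stream with noise. -/
lemma exists_sprt_bound_null {I : ∀ k, (S k).param → (S k).param → ℝ} {k : Fin K}
    (hconv : (S k).CompleteConvergence (E k) (I k)) {θ : ∀ k, (S k).param} (hθ : θ k ∈ (S k).null)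
    {s : ℝ} (hs : 0 < s) (hsr : s < (S k).rateAlt (I k) (θ k)) :
    ∃ c : ℝ≥0∞, c < ∞ ∧ ∀ a b : ℝ, 0 < a → 0 < b →
      (∀ᵐ ω ∂jointLaw S θ, (sprt S E a b).time k ω < ⊤) ∧
      expTime S θ (sprt S E a b) k ≤ ENNReal.ofReal (b / s) + c := by
  obtain ⟨p, hp, hpF⟩ := DataStream.exists_summable_not_favors (E k) (Q := (S k).alt) hθ hs hsr
    (hconv.2 (θ k) hθ)
  refine ⟨2 + ∑' n, p n, ENNReal.add_lt_top.2 ⟨by simp, hp⟩, fun a b ha hb => ?_⟩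
  refine time_bound (sprt_adaptedTo S E a b) hs hp hpF hb fun n ω h => sprtTime_le ?_
  rw [← DataStream.adaptiveLLR_le_iff (E k) hb] at h
  exact fun h' => h.not_gt h'.1

lemma jointLaw_dec_le (θ : ∀ k, (S k).param) {k : Fin K} (hθ : θ k ∈ (S k).null) {a b : ℝ}
    (ha : 0 < a) :
    jointLaw S θ {ω | (sprt S E a b).dec k ω} ≤ ENNReal.ofReal (Real.exp (-a)) := by
  refine (measure_mono ?_).trans ((jointLaw_preimage_le S θ k _).trans
    (DataStream.law_exists_favors_le (E k) (S k).alt hθ a))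
  rintro ω ⟨n, -, h⟩
  exact ⟨n, (DataStream.le_adaptiveLLR_iff (E k) ha n _).1 h⟩

/-- A path that never stops counts as not deciding for a signal, so almost sure termination is
needed. A path that stops without that decision has left the interval at its lower end. -/
lemma jointLaw_not_dec_le (θ : ∀ k, (S k).param) {k : Fin K} (hθ : θ k ∈ (S k).alt) {a b : ℝ}
    (hb : 0 < b) (hT : ∀ᵐ ω ∂jointLaw S θ, (sprt S E a b).time k ω < ⊤) :
    jointLaw S θ {ω | ¬ (sprt S E a b).dec k ω} ≤ ENNReal.ofReal (Real.exp (-b)) := by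
  refine (measure_mono_ae ?_).trans ((jointLaw_preimage_le S θ k _).trans
    (DataStream.law_exists_favors_le (E k) (S k).null hθ b))
  filter_upwards [hT] with ω hω hD
  obtain ⟨n, hn⟩ := ENat.ne_top_iff_exists.1 hω.ne
  refine ⟨n, (DataStream.adaptiveLLR_le_iff (E k) hb n _).1 ?_⟩
  have hnot := ((sprtTime_eq_iff S E a b k ω n).1 hn.symm).1.2
  by_contra hlt
  refine hD ⟨n, hn.symm, ?_⟩
  by_contra hlt'
  exact hnot ⟨not_le.1 hlt, not_le.1 hlt'⟩

/-- Union bound: `A.card * exp (-c) = r * A.card * exp (-M) ≤ r`. -/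
lemma jointLaw_exists_le (θ : ∀ k, (S k).param) (A : Finset (Fin K))
    (D : Fin K → (∀ k, ℕ → X k) → Prop) {c M r : ℝ} (hc : c = |Real.log r| + M)
    (hr : r ∈ Set.Ioo (0 : ℝ) 1) (hM : Real.log A.card ≤ M)
    (h : ∀ j ∈ A, jointLaw S θ {ω | D j ω} ≤ ENNReal.ofReal (Real.exp (-c))) :
    jointLaw S θ {ω | ∃ j, j ∈ A ∧ D j ω} ≤ ENNReal.ofReal r := by
  have hU : {ω | ∃ j, j ∈ A ∧ D j ω} = ⋃ j ∈ A, {ω | D j ω} := by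
    ext ω
    simp
  rw [hU]
  refine (measure_biUnion_finset_le _ _).trans ((Finset.sum_le_sum h).trans ?_)
  rw [Finset.sum_const, nsmul_eq_mul, ← ENNReal.ofReal_natCast,
    ← ENNReal.ofReal_mul (Nat.cast_nonneg _)]
  refine ENNReal.ofReal_le_ofReal ?_
  rcases A.card.eq_zero_or_pos with h0 | h0
  · simp [h0, hr.1.le]
  have hpos : (0 : ℝ) < A.card := by exact_mod_cast h0
  rw [hc, abs_of_neg (Real.log_neg hr.1 hr.2), neg_add, neg_neg, Real.exp_add,
    Real.exp_log hr.1, Real.exp_neg]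
  have hle : (A.card : ℝ) ≤ Real.exp M := (Real.log_le_iff_le_exp hpos).1 hM
  have := Real.exp_pos M
  rw [mul_left_comm, ← div_eq_mul_inv]
  exact mul_le_of_le_one_right hr.1.le ((div_le_one this).2 hle)

end SeqTest

/-! ### Lower bound by change of measure -/

namespace SeqTest

section Rate

variable {X : Type*} [MeasurableSpace X] (S : DataStream X)

/-- The event that the log-likelihood ratio of `θ` against `u` exceeds `c` by time `m`. -/
def ratioExceeds (θ u : S.param) (m : ℕ) (c : ℝ) : Set (ℕ → X) :=
  {x | ∃ n ≤ m, c < S.loglik n θ (pre n x) - S.loglik n u (pre n x)}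

lemma measurable_loglik_pre (n : ℕ) (θ : S.param) :
    Measurable fun x : ℕ → X => S.loglik n θ (pre n x) :=
  (S.measurable_loglik n θ).comp (measurable_pre n)

lemma measurableSet_ratioExceeds (θ u : S.param) (m : ℕ) (c : ℝ) :
    MeasurableSet (ratioExceeds S θ u m c) := by
  have : ratioExceeds S θ u m c = ⋃ n ∈ Finset.range (m + 1),
      {x | c < S.loglik n θ (pre n x) - S.loglik n u (pre n x)} := by
    ext x
    simp [ratioExceeds]
  rw [this]
  exact Finset.measurableSet_biUnion _ fun n _ =>
    measurableSet_lt measurable_const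
      ((measurable_loglik_pre S n θ).sub (measurable_loglik_pre S n u))

/-- Terms beyond some `N` satisfy `z n ≤ n * c ≤ m * c`; the finitely many earlier ones are
overtaken because `m * c → ∞`. Both uses need `c` to be positive. -/
lemma eventually_forall_le_mul {z : ℕ → ℝ} {c : ℝ} (hc : 0 < c)
    (h : ∀ᶠ n in atTop, z n ≤ n * c) : ∀ᶠ m : ℕ in atTop, ∀ n ≤ m, z n ≤ m * c := by
  obtain ⟨N, hN⟩ := eventually_atTop.1 h
  have h1 : ∀ᶠ m : ℕ in atTop, ∀ n ∈ Finset.range N, z n ≤ m * c :=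
    (Finset.eventually_all _).2 fun n _ =>
      (tendsto_natCast_atTop_atTop.atTop_mul_const hc).eventually_ge_atTop (z n)
  filter_upwards [h1] with m hm n hn
  rcases lt_or_ge n N with h2 | h2
  · exact hm n (Finset.mem_range.2 h2)
  · refine (hN n h2).trans ?_
    gcongr

/-- The bound on the limsup controls the running maximum almost surely, so the indicators of these
events tend to zero almost surely, and hence so do the probabilities. -/
lemma tendsto_law_ratioExceeds {I : S.param → S.param → ℝ} (hI : S.RateBound I) (θ u : S.param)
    {c : ℝ} (hc : I θ u < c) :
    Tendsto (fun m : ℕ => S.law θ (ratioExceeds S θ u m (m * c))) atTop (𝓝 0) := by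
  obtain ⟨hpos, hlim⟩ := hI θ u
  rw [← measure_empty (μ := S.law θ)]
  refine tendsto_measure_of_ae_tendsto_indicator_of_isFiniteMeasure atTop MeasurableSet.empty
    (fun m => measurableSet_ratioExceeds S θ u m _) ?_
  filter_upwards [hlim] with x hx
  have h1 := eventually_lt_of_limsup_lt (hx.trans_lt (EReal.coe_lt_coe_iff.2 hc))
  have h2 : ∀ᶠ n : ℕ in atTop,
      S.loglik n θ (pre n x) - S.loglik n u (pre n x) ≤ n * c := by
    filter_upwards [h1, eventually_gt_atTop 0] with n hn h0
    rw [EReal.coe_lt_coe_iff, div_lt_iff₀ (by exact_mod_cast h0)] at hn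
    linarith
  filter_upwards [eventually_forall_le_mul (hpos.trans hc) h2] with m hm
  simp only [ratioExceeds, Set.mem_ofPred_eq, Set.mem_empty_iff_false, iff_false]
  rintro ⟨n, hn, hlt⟩
  exact (hm n hn).not_gt hlt

lemma law_le_mul_law (θ u : S.param) (n : ℕ) (c : ℝ) {G : Set (Fin n → X)} (hG : MeasurableSet G)
    (hle : ∀ h ∈ G, S.loglik n θ h - S.loglik n u h ≤ c) :
    S.law θ (pre n ⁻¹' G) ≤ ENNReal.ofReal (Real.exp c) * S.law u (pre n ⁻¹' G) := by
  rw [S.law_pre n θ hG, S.law_pre n u hG, ← lintegral_const_mul _ (S.measurable_dens n u)]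
  refine setLIntegral_mono ((S.measurable_dens n u).const_mul _) fun h hh => ?_
  rw [DataStream.dens, DataStream.dens, ← ENNReal.ofReal_mul (Real.exp_nonneg _), ← Real.exp_add]
  refine ENNReal.ofReal_le_ofReal (Real.exp_le_exp.2 ?_)
  have := hle h hh
  linarith

end Rate

variable {K : ℕ} {X : Fin K → Type*} [∀ k, MeasurableSpace (X k)] {S : ∀ k, DataStream (X k)}

/-- Decentralization enters here: `s` depends on stream `k` alone, so `θ` and `θ'` may differ
arbitrarily in all other streams at no cost. -/
lemma jointLaw_le_mul_jointLaw (θ θ' : ∀ k, (S k).param) (k : Fin K) (n : ℕ) (c : ℝ)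
    {s : Set (∀ k, ℕ → X k)} (hs : MeasurableSet[streamSigma X k n] s) :
    jointLaw S θ (s ∩ {ω | (S k).loglik n (θ k) (pre n (ω k)) -
      (S k).loglik n (θ' k) (pre n (ω k)) ≤ c}) ≤
      ENNReal.ofReal (Real.exp c) * jointLaw S θ' s := by
  rw [streamSigma_eq] at hs
  obtain ⟨G, hG, rfl⟩ := hs
  set H : Set (Fin n → X k) :=
    {h | (S k).loglik n (θ k) h - (S k).loglik n (θ' k) h ≤ c} with hH
  have hHm : MeasurableSet H := measurableSet_le
    (((S k).measurable_loglik n _).sub ((S k).measurable_loglik n _)) measurable_const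
  have h1 := jointLaw_preimage S θ k (measurable_pre n (hG.inter hHm))
  have h2 := jointLaw_preimage S θ' k (measurable_pre n (hG.inter hHm))
  calc _ = (S k).law (θ k) (pre n ⁻¹' (G ∩ H)) := h1
    _ ≤ ENNReal.ofReal (Real.exp c) * (S k).law (θ' k) (pre n ⁻¹' (G ∩ H)) :=
      law_le_mul_law (S k) _ _ n c (hG.inter hHm) fun h hh => hh.2
    _ ≤ _ := by
      rw [← h2]
      gcongr
      exact fun ω hω => hω.1

/-- A test of `θ k` against `θ' k` that is based on stream `k` and has small error probabilities
cannot stop before the log-likelihood ratio is large. -/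
lemma jointLaw_time_le {T : (∀ k, ℕ → X k) → ℕ∞} {D : Set (∀ k, ℕ → X k)} {k : Fin K}
    (hTD : ∀ n : ℕ, MeasurableSet[streamSigma X k n] ({ω | T ω = n} ∩ D))
    (θ θ' : ∀ k, (S k).param) (m : ℕ) (c : ℝ) :
    jointLaw S θ {ω | T ω ≤ m} ≤ jointLaw S θ Dᶜ +
      (ENNReal.ofReal (Real.exp c) * jointLaw S θ' D +
        (S k).law (θ k) (ratioExceeds (S k) (θ k) (θ' k) m c)) := by
  set s : ℕ → Set (∀ k, ℕ → X k) := fun n => {ω | T ω = n} ∩ D with hs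
  set R : ℕ → Set (∀ k, ℕ → X k) := fun n => {ω | (S k).loglik n (θ k) (pre n (ω k)) -
      (S k).loglik n (θ' k) (pre n (ω k)) ≤ c} with hR
  -- Stopping by time `m` means a decision outside `D`, a decision in `D` with a small likelihood
  -- ratio at the stopping time, or a large ratio at that time.
  have hsub : {ω | T ω ≤ m} ⊆ Dᶜ ∪ ((⋃ n ∈ Finset.range (m + 1), s n ∩ R n) ∪
      {ω | ω k ∈ ratioExceeds (S k) (θ k) (θ' k) m c}) := by
    intro ω hω
    obtain ⟨n, hn⟩ := ENat.ne_top_iff_exists.1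
      (ne_top_of_le_ne_top (ENat.natCast_ne_top m) hω)
    have hnm : n ≤ m := by
      have : (n : ℕ∞) ≤ m := hn.symm ▸ hω
      exact_mod_cast this
    by_cases h1 : ω ∈ D
    · by_cases h2 : ω ∈ R n
      · refine Or.inr (Or.inl ?_)
        simp only [Set.mem_iUnion]
        exact ⟨n, Finset.mem_range.2 (Nat.lt_succ_iff.2 hnm), ⟨hn.symm, h1⟩, h2⟩
      · exact Or.inr (Or.inr ⟨n, hnm, not_le.1 h2⟩)
    · exact Or.inl h1
  refine (measure_mono hsub).trans ((measure_union_le _ _).trans (add_le_add_right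
    ((measure_union_le _ _).trans (add_le_add ?_ (jointLaw_preimage_le S θ k _))) _))
  calc _ ≤ ∑ n ∈ Finset.range (m + 1), jointLaw S θ (s n ∩ R n) := measure_biUnion_finset_le _ _
    _ ≤ ∑ n ∈ Finset.range (m + 1), ENNReal.ofReal (Real.exp c) * jointLaw S θ' (s n) :=
      Finset.sum_le_sum fun n _ => jointLaw_le_mul_jointLaw θ θ' k n c (hTD n)
    _ = ENNReal.ofReal (Real.exp c) *
        jointLaw S θ' (⋃ n ∈ Finset.range (m + 1), s n) := by
      -- The events are disjoint in `n`, so the factor `exp c` is paid once and not `m + 1` times.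
      rw [← Finset.mul_sum, measure_biUnion_finset]
      · intro i _ j _ hij
        refine Set.disjoint_left.2 fun ω h1 h2 => hij ?_
        have : (i : ℕ∞) = j := h1.1.symm.trans h2.1
        exact_mod_cast this
      · exact fun n _ => streamSigma_le_pi k n _ (hTD n)
    _ ≤ _ := by
      gcongr
      exact Set.iUnion₂_subset fun n _ => Set.inter_subset_right

lemma tendsto_abs_log_nhdsGT : Tendsto (fun α : ℝ => |Real.log α|) (𝓝[>] 0) atTop :=
  tendsto_abs_atBot_atTop.comp Real.tendsto_log_nhdsGT_zero

/-- Lower bound for the expected decision time of tests of `θ k` against `θ' k`, where `p.1`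
bounds the error probability under `θ'` and `p.2` that under `θ`. -/
lemma eventually_le_lintegral_time {k : Fin K} {I : (S k).param → (S k).param → ℝ}
    (hI : (S k).RateBound I) (θ θ' : ∀ k, (S k).param) {s t : ℝ} (hs : 0 < s) (hst : s < t)
    (ht : t * I (θ k) (θ' k) < 1) :
    ∀ᶠ p : ℝ × ℝ in levels, ∀ (T : (∀ k, ℕ → X k) → ℕ∞) (D : Set (∀ k, ℕ → X k)),
      (∀ n : ℕ, MeasurableSet[streamSigma X k n] {ω | T ω = n}) →
      (∀ n : ℕ, MeasurableSet[streamSigma X k n] ({ω | T ω = n} ∩ D)) →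
      jointLaw S θ' D ≤ ENNReal.ofReal p.1 → jointLaw S θ Dᶜ ≤ ENNReal.ofReal p.2 →
      ENNReal.ofReal (s * |Real.log p.1|) ≤ ∫⁻ ω, (T ω : ℝ≥0∞) ∂jointLaw S θ := by
  have ht0 : 0 < t := hs.trans hst
  obtain ⟨C, hC, hC'⟩ : ∃ C, I (θ k) (θ' k) < C ∧ C < 1 / t :=
    exists_between (by rwa [lt_div_iff₀ ht0, mul_comm])
  have hC0 : 0 < C := (hI (θ k) (θ' k)).1.trans hC
  have htC : t * C < 1 := by rwa [lt_div_iff₀ ht0, mul_comm] at hC'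
  -- With `c = m * C`, the change of measure costs `exp (m * C) * α ≤ α ^ (1 - t * C)`, which
  -- vanishes as `t * C < 1`; the ratio term vanishes as `C` exceeds the rate.
  set m : ℝ → ℕ := fun α => ⌊t * |Real.log α|⌋₊ with hm
  have hfst : Tendsto (Prod.fst : ℝ × ℝ → ℝ) levels (𝓝[>] 0) := tendsto_fst
  have hsnd : Tendsto (Prod.snd : ℝ × ℝ → ℝ) levels (𝓝[>] 0) := tendsto_snd
  have hlog := tendsto_abs_log_nhdsGT.comp hfst
  have h1 : Tendsto (fun p : ℝ × ℝ => ENNReal.ofReal p.2) levels (𝓝 0) := by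
    rw [← ENNReal.ofReal_zero]
    exact ENNReal.tendsto_ofReal (hsnd.mono_right nhdsWithin_le_nhds)
  have h2 : Tendsto (fun p : ℝ × ℝ => ENNReal.ofReal (Real.exp (-((1 - t * C) * |Real.log p.1|))))
      levels (𝓝 0) := by
    rw [← ENNReal.ofReal_zero]
    exact ENNReal.tendsto_ofReal (Real.tendsto_exp_neg_atTop_nhds_zero.comp
      (hlog.const_mul_atTop (by linarith)))
  have h3 : Tendsto (fun p : ℝ × ℝ => (S k).law (θ k)
      (ratioExceeds (S k) (θ k) (θ' k) (m p.1) (m p.1 * C))) levels (𝓝 0) :=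
    (tendsto_law_ratioExceeds (S k) hI (θ k) (θ' k) hC).comp
      (tendsto_nat_floor_atTop.comp (hlog.const_mul_atTop ht0))
  have h4 := h1.add (h2.add h3)
  simp only [add_zero] at h4
  -- Early stopping eventually has probability at most `1 - s / t`; then Markov's inequality gives
  -- `(m + 1) * (s / t) ≥ s * |log α|`.
  have hδ : 0 < 1 - s / t := by
    rw [sub_pos, div_lt_one ht0]
    exact hst
  have hmem : ∀ᶠ p : ℝ × ℝ in levels, p.1 ∈ Set.Ioo (0 : ℝ) 1 :=
    hfst.eventually (Ioo_mem_nhdsGT one_pos)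
  filter_upwards [h4.eventually_le_const (ENNReal.ofReal_pos.2 hδ), hmem]
    with p hp hp1 T D hT hTD hD1 hD2
  have hexp : ENNReal.ofReal (Real.exp (m p.1 * C)) * ENNReal.ofReal p.1 ≤
      ENNReal.ofReal (Real.exp (-((1 - t * C) * |Real.log p.1|))) := by
    rw [← ENNReal.ofReal_mul (Real.exp_nonneg _)]
    refine ENNReal.ofReal_le_ofReal ?_
    have hfl : (m p.1 : ℝ) ≤ t * |Real.log p.1| := Nat.floor_le (by positivity)
    have hpe : p.1 = Real.exp (-|Real.log p.1|) := by
      rw [abs_of_neg (Real.log_neg hp1.1 hp1.2), neg_neg, Real.exp_log hp1.1]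
    calc Real.exp (m p.1 * C) * p.1
        = Real.exp (m p.1 * C + -|Real.log p.1|) := by rw [Real.exp_add, ← hpe]
      _ ≤ _ := Real.exp_le_exp.2 (by nlinarith)
  have hle : jointLaw S θ {ω | T ω ≤ m p.1} ≤ ENNReal.ofReal (1 - s / t) := by
    refine (jointLaw_time_le hTD θ θ' (m p.1) (m p.1 * C)).trans (le_trans ?_ hp)
    gcongr
    exact (mul_le_mul_right hD1 _).trans hexp
  have hT' : ∀ n : ℕ, MeasurableSet {ω | T ω = n} := fun n => streamSigma_le_pi k n _ (hT n)
  have hlt : ENNReal.ofReal (s / t) ≤ jointLaw S θ {ω | (m p.1 : ℕ∞) < T ω} := by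
    have hcompl : {ω | (m p.1 : ℕ∞) < T ω} = {ω | T ω ≤ m p.1}ᶜ := by
      ext ω
      simp
    rw [hcompl, prob_compl_eq_one_sub (measurableSet_time_le hT' _)]
    refine le_trans ?_ (tsub_le_tsub_left hle 1)
    rw [← ENNReal.ofReal_one, ← ENNReal.ofReal_sub _ hδ.le, sub_sub_cancel]
  refine le_trans ?_ (mul_measure_le_lintegral_time hT' _ (m p.1))
  refine le_trans ?_ (mul_le_mul_right hlt _)
  rw [← ENNReal.ofReal_natCast, ← ENNReal.ofReal_mul (Nat.cast_nonneg _)]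
  refine ENNReal.ofReal_le_ofReal ?_
  have hfl : t * |Real.log p.1| ≤ (m p.1 + 1 : ℕ) := by
    push_cast
    exact (Nat.lt_floor_add_one _).le
  calc s * |Real.log p.1| = t * |Real.log p.1| * (s / t) := by field_simp
    _ ≤ _ := by gcongr

end SeqTest

/-! ### Asymptotic comparison and conclusion -/

namespace SeqTest

lemma tendsto_div_one_of_bounds {V : ℝ × ℝ → ℝ≥0∞} {L : ℝ × ℝ → ℝ} {r : ℝ} (hr : 0 < r)
    (hL : Tendsto L levels atTop)
    (hlow : ∀ s, 0 < s → s < 1 / r → ∀ᶠ p in levels, ENNReal.ofReal (s * L p) ≤ V p)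
    (hup : ∀ s, 1 / r < s → ∀ᶠ p in levels, V p ≤ ENNReal.ofReal (s * L p)) :
    Tendsto (fun p => V p / ENNReal.ofReal (L p / r)) levels (𝓝 1) := by
  have hmul : ∀ q : ℝ, 0 ≤ q → ∀ p,
      ENNReal.ofReal (q / r * L p) = ENNReal.ofReal q * ENNReal.ofReal (L p / r) := by
    intro q hq p
    rw [← ENNReal.ofReal_mul hq]
    congr 1
    ring
  refine tendsto_order.2 ⟨fun a' ha' => ?_, fun a' ha' => ?_⟩
  · obtain ⟨q, -, h1, h2⟩ := ENNReal.lt_iff_exists_real_btwn.1 ha'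
    have hq0 : 0 < q := ENNReal.ofReal_pos.1 (zero_le.trans_lt h1)
    have hq1 : q < 1 := by rwa [← ENNReal.ofReal_one, ENNReal.ofReal_lt_ofReal_iff one_pos] at h2
    filter_upwards [hlow (q / r) (by positivity) (by gcongr), hL.eventually_gt_atTop 0] with p hp h0
    refine h1.trans_le ?_
    rw [ENNReal.le_div_iff_mul_le (Or.inl (ENNReal.ofReal_pos.2 (by positivity)).ne')
      (Or.inl ENNReal.ofReal_ne_top), ← hmul q hq0.le]
    exact hp
  · obtain ⟨q, hq0, h1, h2⟩ := ENNReal.lt_iff_exists_real_btwn.1 ha'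
    have hq1 : 1 < q := by
      by_contra h
      exact h1.not_ge (ENNReal.ofReal_one ▸ ENNReal.ofReal_le_ofReal (not_lt.1 h))
    filter_upwards [hup (q / r) (by gcongr)] with p hp
    refine lt_of_le_of_lt ?_ h2
    rw [hmul q hq0] at hp
    exact ENNReal.div_le_of_le_mul hp

/-- As `O ≤ U`, lower bounds for `O` and upper bounds for `U` sandwich both. Each is then equivalent
to `L / r`, and the quotient of the two ratios compares them. -/
lemma asympEq_of_bounds {U O : ℝ → ℝ → ℝ≥0∞} {L : ℝ → ℝ → ℝ} {r : ℝ} (hr : 0 < r)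
    (hL : Tendsto (fun p : ℝ × ℝ => L p.1 p.2) levels atTop)
    (hOU : ∀ᶠ p : ℝ × ℝ in levels, O p.1 p.2 ≤ U p.1 p.2)
    (hlow : ∀ s, 0 < s → s < 1 / r →
      ∀ᶠ p : ℝ × ℝ in levels, ENNReal.ofReal (s * L p.1 p.2) ≤ O p.1 p.2)
    (hup : ∀ s, 1 / r < s →
      ∀ᶠ p : ℝ × ℝ in levels, U p.1 p.2 ≤ ENNReal.ofReal (s * L p.1 p.2)) :
    AsympEq U O ∧ AsympEq O (fun α β => ENNReal.ofReal (L α β / r)) := by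
  have h1 := tendsto_div_one_of_bounds (V := fun p => O p.1 p.2) hr hL hlow fun s hs => by
    filter_upwards [hOU, hup s hs] with p h1 h2 using h1.trans h2
  have h2 := tendsto_div_one_of_bounds (V := fun p => U p.1 p.2) hr hL (fun s h0 hs => by
    filter_upwards [hOU, hlow s h0 hs] with p h1 h2 using h2.trans h1) hup
  refine ⟨?_, h1⟩
  have h3 := ENNReal.Tendsto.div h2 (Or.inl one_ne_zero) h1 (Or.inl ENNReal.one_ne_top)
  rw [div_one] at h3
  refine h3.congr' ?_
  filter_upwards [hL.eventually_gt_atTop 0] with p hp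
  have h0 : ENNReal.ofReal (L p.1 p.2 / r) ≠ 0 := (ENNReal.ofReal_pos.2 (by positivity)).ne'
  simp only [div_eq_mul_inv (U p.1 p.2), div_eq_mul_inv (O p.1 p.2)]
  exact ENNReal.mul_div_mul_right _ _ (ENNReal.inv_ne_zero.2 ENNReal.ofReal_ne_top)
    (ENNReal.inv_ne_top.2 h0)

lemma eventually_add_const_le {a L : ℝ × ℝ → ℝ} (hL : Tendsto L levels atTop)
    (ha : Tendsto (fun p => a p / L p) levels (𝓝 1)) {s t : ℝ} (ht : 0 < t) (hst : 1 < s * t)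
    {c : ℝ≥0∞} (hc : c < ∞) :
    ∀ᶠ p in levels, ENNReal.ofReal (a p / t) + c ≤ ENNReal.ofReal (s * L p) := by
  -- The midpoint of `1` and `s * t`: eventually `a ≤ q * L`, and the remaining `(s - q / t) * L`
  -- absorbs the constant `c`.
  set q := (1 + s * t) / 2 with hq
  have hpos : 0 < s - q / t := by
    rw [sub_pos, div_lt_iff₀ ht]
    linarith
  filter_upwards [ha.eventually_lt_const (show 1 < q by linarith), hL.eventually_gt_atTop 0,
    (hL.atTop_mul_const hpos).eventually_ge_atTop c.toReal] with p h1 h2 h3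
  rw [div_lt_iff₀ h2] at h1
  have hq0 : 0 < q := by linarith
  calc ENNReal.ofReal (a p / t) + c
      ≤ ENNReal.ofReal (q * L p / t) + ENNReal.ofReal c.toReal := by
        rw [ENNReal.ofReal_toReal hc.ne]
        gcongr
    _ = ENNReal.ofReal (q * L p / t + c.toReal) :=
        (ENNReal.ofReal_add (by positivity) ENNReal.toReal_nonneg).symm
    _ ≤ _ := ENNReal.ofReal_le_ofReal (by
        have : q * L p / t = L p * (q / t) := by ring
        rw [this]
        nlinarith)

lemma tendsto_fst_levels : Tendsto (Prod.fst : ℝ × ℝ → ℝ) levels (𝓝[>] 0) := tendsto_fst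

lemma tendsto_snd_levels : Tendsto (Prod.snd : ℝ × ℝ → ℝ) levels (𝓝[>] 0) := tendsto_snd

lemma tendsto_swap_levels : Tendsto (Prod.swap : ℝ × ℝ → ℝ × ℝ) levels levels :=
  tendsto_snd_levels.prodMk tendsto_fst_levels

lemma eventually_levels_mem :
    ∀ᶠ p : ℝ × ℝ in levels, p.1 ∈ Set.Ioo (0 : ℝ) 1 ∧ p.2 ∈ Set.Ioo (0 : ℝ) 1 :=
  (tendsto_fst_levels.eventually (Ioo_mem_nhdsGT one_pos)).and
    (tendsto_snd_levels.eventually (Ioo_mem_nhdsGT one_pos))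

lemma tendsto_abs_log_add_div (M : ℝ) :
    Tendsto (fun α : ℝ => (|Real.log α| + M) / |Real.log α|) (𝓝[>] 0) (𝓝 1) := by
  have h := (tendsto_const_nhds (x := (1 : ℝ))).add
    (tendsto_abs_log_nhdsGT.const_div_atTop M)
  rw [add_zero] at h
  refine h.congr' ?_
  filter_upwards [tendsto_abs_log_nhdsGT.eventually_gt_atTop 0] with α hα
  field_simp

variable {K : ℕ} {X : Fin K → Type*} [∀ k, MeasurableSpace (X k)] {S : ∀ k, DataStream (X k)}
  {E : ∀ k, Estimator (S k)} {I : ∀ k, (S k).param → (S k).param → ℝ}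
  {prior : Set (Finset (Fin K))}

/-- Completes a one-stream alternative to a full parameter. Any completion serves, since the error
control is uniform over consistent parameters. -/
lemma exists_consistent (B : Finset (Fin K)) (k : Fin K) {u : (S k).param}
    (h1 : k ∈ B → u ∈ (S k).alt) (h0 : k ∉ B → u ∈ (S k).null) :
    ∃ θ ∈ consistent S B, θ k = u := by
  classical
  refine ⟨Function.update
    (fun j => if j ∈ B then (S j).alt_nonempty.some else (S j).null_nonempty.some) k u,
    ⟨fun i hi => ?_, fun j hj => ?_⟩, Function.update_self _ _ _⟩
  · rcases eq_or_ne i k with rfl | h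
    · rw [Function.update_self]
      exact h1 hi
    · rw [Function.update_of_ne h, if_pos hi]
      exact (S i).alt_nonempty.some_mem
  · rcases eq_or_ne j k with rfl | h
    · rw [Function.update_self]
      exact h0 hj
    · rw [Function.update_of_ne h, if_neg hj]
      exact (S j).null_nonempty.some_mem

lemma jointLaw_dec_le_of_controlled {α β : ℝ} {χ : Procedure X} (h : χ ∈ controlled S prior α β)
    {B : Finset (Fin K)} (hB : B ∈ prior) {θ : ∀ k, (S k).param} (hθ : θ ∈ consistent S B)
    {k : Fin K} (hk : k ∉ B) : jointLaw S θ {ω | χ.dec k ω} ≤ ENNReal.ofReal α :=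
  (measure_mono (t := {ω | ∃ j, j ∉ B ∧ χ.dec j ω}) fun _ hω => ⟨k, hk, hω⟩).trans
    ((le_iSup₂ (f := fun θ (_ : θ ∈ consistent S B) =>
      jointLaw S θ {ω | ∃ j, j ∉ B ∧ χ.dec j ω}) θ hθ).trans (h.2 B hB).2.1)

lemma jointLaw_not_dec_le_of_controlled {α β : ℝ} {χ : Procedure X}
    (h : χ ∈ controlled S prior α β)
    {B : Finset (Fin K)} (hB : B ∈ prior) {θ : ∀ k, (S k).param} (hθ : θ ∈ consistent S B)
    {k : Fin K} (hk : k ∈ B) : jointLaw S θ {ω | ¬ χ.dec k ω} ≤ ENNReal.ofReal β :=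
  (measure_mono (t := {ω | ∃ i, i ∈ B ∧ ¬ χ.dec i ω}) fun _ hω => ⟨k, hk, hω⟩).trans
    ((le_iSup₂ (f := fun θ (_ : θ ∈ consistent S B) =>
      jointLaw S θ {ω | ∃ i, i ∈ B ∧ ¬ χ.dec i ω}) θ hθ).trans (h.2 B hB).2.2)

/-- The infimum of the rates need not be attained, but the strict inequality leaves room for a
single competing parameter. -/
lemma exists_rate_lt {t : ℝ} {ι : Type*} [Nonempty ι] {f : ι → ℝ} (hf : 0 < ⨅ u, f u)
    (h : t < 1 / ⨅ u, f u) (h0 : 0 < t) : ∃ u, t * f u < 1 := by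
  rw [lt_div_iff₀ hf, mul_comm, ← lt_div_iff₀ h0] at h
  obtain ⟨u, hu⟩ := exists_lt_of_ciInf_lt h
  rw [lt_div_iff₀ h0, mul_comm] at hu
  exact ⟨u, hu⟩

lemma eventually_le_optTime_alt (hrate : ∀ k, (S k).RateBound (I k))
    (hprior : ∀ k, ∃ A ∈ prior, ∃ B ∈ prior, k ∈ A ∧ k ∉ B)
    {A : Finset (Fin K)} (hA : A ∈ prior) {θ : ∀ k, (S k).param} (hθ : θ ∈ consistent S A)
    {i : Fin K} (hi : i ∈ A) (hr : 0 < (S i).rateNull (I i) (θ i)) {s : ℝ} (hs : 0 < s)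
    (hsr : s < 1 / (S i).rateNull (I i) (θ i)) :
    ∀ᶠ p : ℝ × ℝ in levels,
      ENNReal.ofReal (s * |Real.log p.1|) ≤ optTime S prior θ i p.1 p.2 := by
  obtain ⟨t, hst, htr⟩ := exists_between hsr
  have : Nonempty (S i).null := (S i).null_nonempty.to_subtype
  obtain ⟨u, hu⟩ := exists_rate_lt hr htr (hs.trans hst)
  obtain ⟨_, _, B, hB, _, hiB⟩ := hprior i
  obtain ⟨θ', hθ', hθu⟩ := exists_consistent B i (fun h => absurd h hiB) (fun _ => u.2)
  filter_upwards [eventually_le_lintegral_time (hrate i) θ θ' hs hst (hθu ▸ hu)] with p hp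
  -- The bound `hp` holds for all times and decisions at the same levels, so it passes to the
  -- infimum over procedures.
  refine le_iInf₂ fun χ hχ => ?_
  have had := (hχ.1.2 i).2.2
  exact hp (χ.time i) {ω | χ.dec i ω} (fun n => (had n).1) (fun n => (had n).2.1)
    (jointLaw_dec_le_of_controlled hχ.2 hB hθ' hiB)
    (jointLaw_not_dec_le_of_controlled hχ.2 hA hθ hi)

lemma eventually_le_optTime_null (hrate : ∀ k, (S k).RateBound (I k))
    (hprior : ∀ k, ∃ A ∈ prior, ∃ B ∈ prior, k ∈ A ∧ k ∉ B)
    {A : Finset (Fin K)} (hA : A ∈ prior) {θ : ∀ k, (S k).param} (hθ : θ ∈ consistent S A)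
    {j : Fin K} (hj : j ∉ A) (hr : 0 < (S j).rateAlt (I j) (θ j)) {s : ℝ} (hs : 0 < s)
    (hsr : s < 1 / (S j).rateAlt (I j) (θ j)) :
    ∀ᶠ p : ℝ × ℝ in levels,
      ENNReal.ofReal (s * |Real.log p.2|) ≤ optTime S prior θ j p.1 p.2 := by
  obtain ⟨t, hst, htr⟩ := exists_between hsr
  have : Nonempty (S j).alt := (S j).alt_nonempty.to_subtype
  obtain ⟨u, hu⟩ := exists_rate_lt hr htr (hs.trans hst)
  obtain ⟨B, hB, _, _, hjB, _⟩ := hprior j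
  obtain ⟨θ', hθ', hθu⟩ := exists_consistent B j (fun _ => u.2) (fun h => absurd hjB h)
  -- The errors exchange roles: `D` becomes the decision for noise, whose probability under `θ'` is
  -- bounded by `β`.
  filter_upwards [tendsto_swap_levels.eventually
    (eventually_le_lintegral_time (hrate j) θ θ' hs hst (hθu ▸ hu))] with p hp
  refine le_iInf₂ fun χ hχ => ?_
  have had := (hχ.1.2 j).2.2
  refine hp (χ.time j) {ω | ¬ χ.dec j ω} (fun n => (had n).1) (fun n => (had n).2.2)
    (jointLaw_not_dec_le_of_controlled hχ.2 hB hθ' hjB) ?_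
  refine (measure_mono fun ω hω => ?_).trans (jointLaw_dec_le_of_controlled hχ.2 hA hθ hj)
  exact not_not.1 hω

lemma log_card_le_iSup (f : prior → Finset (Fin K)) (A : prior) :
    Real.log ((f A).card : ℝ) ≤ ⨆ A : prior, Real.log ((f A).card : ℝ) :=
  le_ciSup (f := fun A : prior => Real.log ((f A).card : ℝ)) (Set.finite_range _).bddAbove A

/-- This includes the default values `log 0 = 0` for an empty set and a zero supremum for an empty
`prior`. -/
lemma iSup_log_card_nonneg (f : prior → Finset (Fin K)) :
    0 ≤ ⨆ A : prior, Real.log ((f A).card : ℝ) :=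
  Real.iSup_nonneg fun _ => Real.log_natCast_nonneg _

lemma ae_sprt_time_lt_top (hsep : ∀ k, (S k).Separated (I k))
    (hconv : ∀ k, (S k).CompleteConvergence (E k) (I k)) {A : Finset (Fin K)}
    {θ : ∀ k, (S k).param} (hθ : θ ∈ consistent S A) (k : Fin K) {a b : ℝ} (ha : 0 < a)
    (hb : 0 < b) : ∀ᵐ ω ∂jointLaw S θ, (sprt S E a b).time k ω < ⊤ := by
  by_cases hk : k ∈ A
  · have hpos := (hsep k).1 (θ k) (hθ.1 k hk)
    obtain ⟨c, -, hc⟩ := exists_sprt_bound_alt (E := E) (hconv k) (hθ.1 k hk) (half_pos hpos)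
      (half_lt_self hpos)
    exact (hc a b ha hb).1
  · have hpos := (hsep k).2 (θ k) (hθ.2 k hk)
    obtain ⟨c, -, hc⟩ := exists_sprt_bound_null (E := E) (hconv k) (hθ.2 k hk) (half_pos hpos)
      (half_lt_self hpos)
    exact (hc a b ha hb).1

lemma sprt_mem_controlled (hsep : ∀ k, (S k).Separated (I k))
    (hconv : ∀ k, (S k).CompleteConvergence (E k) (I k)) {α β a b M N : ℝ}
    (hα : α ∈ Set.Ioo (0 : ℝ) 1) (hβ : β ∈ Set.Ioo (0 : ℝ) 1) (ha : 0 < a) (hb : 0 < b)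
    (haM : a = |Real.log α| + M) (hbN : b = |Real.log β| + N)
    (hM : ∀ A ∈ prior, Real.log (Aᶜ.card : ℝ) ≤ M) (hN : ∀ A ∈ prior, Real.log (A.card : ℝ) ≤ N) :
    sprt S E a b ∈ controlled S prior α β := by
  refine ⟨(sprt_mem_decentralized S E _ _).1, fun A hA =>
    ⟨fun θ hθ k => ae_sprt_time_lt_top hsep hconv hθ k ha hb, iSup₂_le fun θ hθ => ?_,
      iSup₂_le fun θ hθ => ?_⟩⟩
  · simp only [← Finset.mem_compl (s := A)]
    exact jointLaw_exists_le θ Aᶜ _ haM hα (hM A hA) fun j hj =>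
      jointLaw_dec_le θ (hθ.2 j (Finset.mem_compl.1 hj)) ha
  · exact jointLaw_exists_le θ A (fun i ω => ¬ (sprt S E a b).dec i ω) hbN hβ (hN A hA)
      fun i hi => jointLaw_not_dec_le θ (hθ.1 i hi) hb (ae_sprt_time_lt_top hsep hconv hθ i ha hb)

/-- The thresholds obtained from Bonferroni's inequality. -/
theorem suitableThresholds_log (hsep : ∀ k, (S k).Separated (I k))
    (hconv : ∀ k, (S k).CompleteConvergence (E k) (I k)) :
    SuitableThresholds S E prior
      (fun α _ => |Real.log α| + ⨆ A : prior, Real.log ((A : Finset (Fin K))ᶜ.card : ℝ))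
      (fun _ β => |Real.log β| + ⨆ A : prior, Real.log ((A : Finset (Fin K)).card : ℝ)) := by
  refine ⟨fun α hα β hβ => ?_, (tendsto_abs_log_add_div _).comp tendsto_fst_levels,
    (tendsto_abs_log_add_div _).comp tendsto_snd_levels⟩
  have ha := add_pos_of_pos_of_nonneg (abs_pos.2 (Real.log_neg hα.1 hα.2).ne)
    (iSup_log_card_nonneg fun A : prior => (A : Finset (Fin K))ᶜ)
  have hb := add_pos_of_pos_of_nonneg (abs_pos.2 (Real.log_neg hβ.1 hβ.2).ne)
    (iSup_log_card_nonneg fun A : prior => (A : Finset (Fin K)))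
  exact ⟨ha, hb, sprt_mem_controlled hsep hconv hα hβ ha hb rfl rfl
    (fun A hA => log_card_le_iSup (fun A : prior => (A : Finset (Fin K))ᶜ) ⟨A, hA⟩)
    (fun A hA => log_card_le_iSup (fun A : prior => (A : Finset (Fin K))) ⟨A, hA⟩)⟩

lemma eventually_optTime_le {a b : ℝ → ℝ → ℝ} (h : SuitableThresholds S E prior a b)
    (θ : ∀ k, (S k).param) (k : Fin K) :
    ∀ᶠ p : ℝ × ℝ in levels, optTime S prior θ k p.1 p.2 ≤
      expTime S θ (sprt S E (a p.1 p.2) (b p.1 p.2)) k := by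
  filter_upwards [eventually_levels_mem] with p hp
  exact iInf₂_le _ ⟨sprt_mem_decentralized S E _ _, (h.1 p.1 hp.1 p.2 hp.2).2.2⟩

lemma exists_rate_gt {r s : ℝ} (hr : 0 < r) (hs : 1 / r < s) : ∃ t, 0 < t ∧ t < r ∧ 1 < s * t := by
  have hs0 : 0 < s := (by positivity : 0 < 1 / r).trans hs
  obtain ⟨t, h1, h2⟩ := exists_between ((one_div_lt hr hs0).1 hs)
  exact ⟨t, (by positivity : 0 < 1 / s).trans h1, h2, by rwa [div_lt_iff₀ hs0, mul_comm] at h1⟩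

lemma eventually_expTime_le_alt (hconv : ∀ k, (S k).CompleteConvergence (E k) (I k))
    {a b : ℝ → ℝ → ℝ} (h : SuitableThresholds S E prior a b) {θ : ∀ k, (S k).param} {i : Fin K}
    (hi : θ i ∈ (S i).alt) (hr : 0 < (S i).rateNull (I i) (θ i)) {s : ℝ}
    (hs : 1 / (S i).rateNull (I i) (θ i) < s) :
    ∀ᶠ p : ℝ × ℝ in levels, expTime S θ (sprt S E (a p.1 p.2) (b p.1 p.2)) i ≤
      ENNReal.ofReal (s * |Real.log p.1|) := by
  obtain ⟨t, ht, htr, hst⟩ := exists_rate_gt hr hs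
  obtain ⟨c, hc, hbound⟩ := exists_sprt_bound_alt (E := E) (hconv i) hi ht htr
  filter_upwards [eventually_levels_mem, eventually_add_const_le
    (tendsto_abs_log_nhdsGT.comp tendsto_fst_levels) h.2.1 ht hst hc] with p hp hle
  obtain ⟨ha, hb, -⟩ := h.1 p.1 hp.1 p.2 hp.2
  exact (hbound _ _ ha hb).2.trans hle

lemma eventually_expTime_le_null (hconv : ∀ k, (S k).CompleteConvergence (E k) (I k))
    {a b : ℝ → ℝ → ℝ} (h : SuitableThresholds S E prior a b) {θ : ∀ k, (S k).param} {j : Fin K}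
    (hj : θ j ∈ (S j).null) (hr : 0 < (S j).rateAlt (I j) (θ j)) {s : ℝ}
    (hs : 1 / (S j).rateAlt (I j) (θ j) < s) :
    ∀ᶠ p : ℝ × ℝ in levels, expTime S θ (sprt S E (a p.1 p.2) (b p.1 p.2)) j ≤
      ENNReal.ofReal (s * |Real.log p.2|) := by
  obtain ⟨t, ht, htr, hst⟩ := exists_rate_gt hr hs
  obtain ⟨c, hc, hbound⟩ := exists_sprt_bound_null (E := E) (hconv j) hj ht htr
  filter_upwards [eventually_levels_mem, eventually_add_const_le
    (tendsto_abs_log_nhdsGT.comp tendsto_snd_levels) h.2.2 ht hst hc] with p hp hle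
  obtain ⟨ha, hb, -⟩ := h.1 p.1 hp.1 p.2 hp.2
  exact (hbound _ _ ha hb).2.trans hle

end SeqTest

theorem theorem7p2 {K : ℕ} {X : Fin K → Type*} [∀ k, MeasurableSpace (X k)]
    (S : ∀ k, SeqTest.DataStream (X k)) (E : ∀ k, SeqTest.Estimator (S k))
    (I : ∀ k, (S k).param → (S k).param → ℝ)
    (hrate : ∀ k, (S k).RateBound (I k))
    (hsep : ∀ k, (S k).Separated (I k))
    (hconv : ∀ k, (S k).CompleteConvergence (E k) (I k))
    (prior : Set (Finset (Fin K)))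
    (hprior : ∀ k, ∃ A ∈ prior, ∃ B ∈ prior, k ∈ A ∧ k ∉ B) :
    SeqTest.SuitableThresholds S E prior
      (fun α _ => |Real.log α| + ⨆ A : prior, Real.log ((A : Finset (Fin K))ᶜ.card : ℝ))
      (fun _ β => |Real.log β| + ⨆ A : prior, Real.log ((A : Finset (Fin K)).card : ℝ)) ∧
    ∀ a b : ℝ → ℝ → ℝ, SeqTest.SuitableThresholds S E prior a b →
      ∀ A ∈ prior, ∀ θ ∈ SeqTest.consistent S A,
        (∀ i ∈ A,
          SeqTest.AsympEq
            (fun α β => SeqTest.expTime S θ (SeqTest.sprt S E (a α β) (b α β)) i)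
            (SeqTest.optTime S prior θ i) ∧
          SeqTest.AsympEq
            (SeqTest.optTime S prior θ i)
            (fun α _ => ENNReal.ofReal (|Real.log α| / (S i).rateNull (I i) (θ i)))) ∧
        (∀ j ∉ A,
          SeqTest.AsympEq
            (fun α β => SeqTest.expTime S θ (SeqTest.sprt S E (a α β) (b α β)) j)
            (SeqTest.optTime S prior θ j) ∧
          SeqTest.AsympEq
            (SeqTest.optTime S prior θ j)
            (fun _ β => ENNReal.ofReal (|Real.log β| / (S j).rateAlt (I j) (θ j)))) := by
  refine ⟨SeqTest.suitableThresholds_log hsep hconv, fun a b hab A hA θ hθ =>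
    ⟨fun i hi => ?_, fun j hj => ?_⟩⟩
  · have hr := (hsep i).1 (θ i) (hθ.1 i hi)
    exact SeqTest.asympEq_of_bounds hr
      (SeqTest.tendsto_abs_log_nhdsGT.comp SeqTest.tendsto_fst_levels)
      (SeqTest.eventually_optTime_le hab θ i)
      (fun s h0 hs => SeqTest.eventually_le_optTime_alt hrate hprior hA hθ hi hr h0 hs)
      (fun s hs => SeqTest.eventually_expTime_le_alt hconv hab (hθ.1 i hi) hr hs)
  · have hr := (hsep j).2 (θ j) (hθ.2 j hj)
    exact SeqTest.asympEq_of_bounds hr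
      (SeqTest.tendsto_abs_log_nhdsGT.comp SeqTest.tendsto_snd_levels)
      (SeqTest.eventually_optTime_le hab θ j)
      (fun s h0 hs => SeqTest.eventually_le_optTime_null hrate hprior hA hθ hj hr h0 hs)
      (fun s hs => SeqTest.eventually_expTime_le_null hconv hab (hθ.2 j hj) hr hs)
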